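/- Let $\mathcal N$ be a countably infinite set (of names). A \emph{prop} $\mathcal S$ is a small symmetric strict monoidal category whose objects are the natural numbers and whose tensor $\oplus$ is addition on objects; $\mathsf{PROP}$ is the category of props and strict symmetric monoidal functors that are the identity on objects. Composition is written $;$ in diagrammatic order. A \emph{nominal prop} $\mathcal T$ is a small category whose objects are the finite subsets of $\mathcal N$, which comes with an arrow $e:A\to B$ for every bijection $e$ between finite subsets of $\mathcal N$ (functorially in $e$; distinct bijections may give equal arrows), and with an associative, unital (unit $\mathrm{id}_\varnothing$) and commutative partial tensor $f\uplus g:A\uplus A'\to B\uplus B'$ of arrows $f:A\to B$, $g:A'\to B'$, defined if $A\cap A'=\varnothing=B\cap B'$, which on bijections is the disjoint union, which satisfies $\mathrm{id}_A\uplus\mathrm{id}_{A'}=\mathrm{id}_{A\uplus A'}$, and which satisfies $(s;t)\uplus(u;v)=(s\uplus u);(t\uplus v)$ whenever both sides are defined. A finite permutation $\pi$ of $\mathcal N$ acts on an arrow $f:A\to B$ by $\pi\cdot f=(\pi|_A)^{-1};f;\pi|_B:\pi[A]\to\pi[B]$. $\mathsf{nPROP}$ is the category of nominal props and functors that are the identity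 on objects, preserve $\uplus$, and are equivariant under finite permutations. Bold letters denote lists of pairwise distinct names, $\underline{\boldsymbol a}$ is the set of members of $\boldsymbol a$, and $+$ is concatenation (of lists whose sets of members are disjoint). For lists $\boldsymbol a,\boldsymbol b$ of equal length, $[\boldsymbol a|\boldsymbol b]:\underline{\boldsymbol a}\to\underline{\boldsymbol b}$ is the bijection $a_i\mapsto b_i$ in a nominal prop. For lists with $\underline{\boldsymbol a}=\underline{\boldsymbol a'}$ of length $n$, $\langle\boldsymbol a|\boldsymbol a'\rangle:n\to n$ is the arrow of a prop, generated from symmetries and identities by $;$ and $\oplus$, whose underlying bijection sends $i$ to the $j$ with $a_i=a'_j$. For a prop $\mathcal S$, $\mathit{NOM}(\mathcal S)$ is the nominal prop presented by generators $[\boldsymbol a\rangle f\langle\boldsymbol b]:\underline{\boldsymbol a}\to\underline{\boldsymbol b}$, for all arrows $f:n\to m$ of $\mathcal S$ and all lists $\boldsymbol a,\boldsymbol b$ of lengths $n,m$, subject to \begin{align*} [\boldsymbol a\rangle f;g\langle\boldsymbol c]&=[\boldsymbol a\rangle f\langle\boldsymbol b];[\boldsymbol b\rangle g\langle\boldsymbol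 c], & [\boldsymbol a+\boldsymbol c\rangle f\oplus g\langle\boldsymbol b+\boldsymbol d]&=[\boldsymbol a\rangle f\langle\boldsymbol b]\uplus[\boldsymbol c\rangle g\langle\boldsymbol d],\\ [\boldsymbol a\rangle\mathrm{id}\langle\boldsymbol b]&=[\boldsymbol a|\boldsymbol b], & [\boldsymbol a\rangle\,\langle\boldsymbol b|\boldsymbol b'\rangle;f\,\langle\boldsymbol c]&=[\boldsymbol a|\boldsymbol b];[\boldsymbol b'\rangle f\langle\boldsymbol c],\\ [\boldsymbol a\rangle\,f;\langle\boldsymbol b|\boldsymbol b'\rangle\,\langle\boldsymbol c]&=[\boldsymbol a\rangle f\langle\boldsymbol b];[\boldsymbol b'|\boldsymbol c]. \end{align*} For a nominal prop $\mathcal T$, $\mathit{ORD}(\mathcal T)$ is the prop presented by generators $\langle\boldsymbol a]f[\boldsymbol b\rangle:n\to m$, for all arrows $f:\underline{\boldsymbol a}\to\underline{\boldsymbol b}$ of $\mathcal T$, where $n,m$ are the lengths of $\boldsymbol a,\boldsymbol b$, subject to \begin{align*} \langle\boldsymbol a]f;g[\boldsymbol c\rangle&=\langle\boldsymbol a]f[\boldsymbol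 b\rangle;\langle\boldsymbol b]g[\boldsymbol c\rangle, & \langle\boldsymbol a+\boldsymbol c]f\uplus g[\boldsymbol b+\boldsymbol d\rangle&=\langle\boldsymbol a]f[\boldsymbol b\rangle\oplus\langle\boldsymbol c]g[\boldsymbol d\rangle,\\ \langle\boldsymbol a]\mathrm{id}[\boldsymbol a\rangle&=\mathrm{id}, & \langle\boldsymbol a]\,[\boldsymbol a'|\boldsymbol b];f\,[\boldsymbol c\rangle&=\langle\boldsymbol a|\boldsymbol a'\rangle;\langle\boldsymbol b]f[\boldsymbol c\rangle,\\ \langle\boldsymbol a]\,f;[\boldsymbol b|\boldsymbol c]\,[\boldsymbol c'\rangle&=\langle\boldsymbol a]f[\boldsymbol b\rangle;\langle\boldsymbol c|\boldsymbol c'\rangle. \end{align*} These are the object parts of functors $\mathit{NOM}:\mathsf{PROP}\to\mathsf{nPROP}$ and $\mathit{ORD}:\mathsf{nPROP}\to\mathsf{PROP}$ with $\mathit{NOM}(F)([\boldsymbol a\rangle f\langle\boldsymbol b])=[\boldsymbol a\rangle Ff\langle\boldsymbol b]$ and $\mathit{ORD}(F)(\langle\boldsymbol a]f[\boldsymbol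 b\rangle)=\langle\boldsymbol a]Ff[\boldsymbol b\rangle$. \textbf{Theorem.} The categories $\mathsf{PROP}$ and $\mathsf{nPROP}$ are equivalent. More precisely, there are natural isomorphisms $\eta_{\mathcal S}:\mathcal S\to\mathit{ORD}(\mathit{NOM}(\mathcal S))$ of props and $\varepsilon_{\mathcal T}:\mathit{NOM}(\mathit{ORD}(\mathcal T))\to\mathcal T$ of nominal props, which are the unit and the counit of an adjoint equivalence with functors $\mathit{NOM}$ and $\mathit{ORD}$, such that \[\eta_{\mathcal S}(f)=\langle\boldsymbol a]\,[\boldsymbol a\rangle f\langle\boldsymbol b]\,[\boldsymbol b\rangle\] for every arrow $f:n\to m$ of $\mathcal S$ and any lists $\boldsymbol a,\boldsymbol b$ of lengths $n,m$, and \[\varepsilon_{\mathcal T}\bigl([\boldsymbol c\rangle\,\langle\boldsymbol a]f[\boldsymbol b\rangle\,\langle\boldsymbol d]\bigr)=[\boldsymbol c|\boldsymbol a];f;[\boldsymbol b|\boldsymbol d]\] for every arrow $f:\underline{\boldsymbol a}\to\underline{\boldsymbol b}$ of $\mathcal T$ and all lists $\boldsymbol c,\boldsymbol d$ of the lengths of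 $\boldsymbol a,\boldsymbol b$. -/

import Mathlib

open CategoryTheory

universe u

noncomputable section

/-! ## Ordinary props -/

/-- The data of a prop: arrows between natural numbers, identities, sequential composition
`f ; g` (in diagrammatic order), parallel composition `f ⊕ g`, which is addition on objects, and
symmetries `σ_{m,n} : m + n → n + m`.

The arguments `k`, `l` and the equations defining them are only bookkeeping: with `rfl` for the
equations one has `f ⊕ g : n + n' → m + m'`. They make it possible to state strict associativity
and strict unitality as plain equations. -/
structure PropSig where
  Hom : ℕ → ℕ → Type u
  id (n : ℕ) : Hom n n
  comp {n m k : ℕ} (f : Hom n m) (g : Hom m k) : Hom n k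
  tensor {n n' k m m' l : ℕ} (hk : n + n' = k) (hl : m + m' = l)
    (f : Hom n m) (g : Hom n' m') : Hom k l
  braid (m n : ℕ) {k l : ℕ} (hk : m + n = k) (hl : n + m = l) : Hom k l

/-- A (MacLane) prop: a symmetric strict monoidal category whose objects are the natural numbers
and whose tensor product is addition on objects. -/
structure PROP extends PropSig.{u} where
  id_comp {n m : ℕ} (f : Hom n m) : comp (id n) f = f
  comp_id {n m : ℕ} (f : Hom n m) : comp f (id m) = f
  assoc {n m k l : ℕ} (f : Hom n m) (g : Hom m k) (h : Hom k l) :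
    comp (comp f g) h = comp f (comp g h)
  tensor_id {n n' k : ℕ} (hk : n + n' = k) : tensor hk hk (id n) (id n') = id k
  interchange {n m p n' m' p' k l q : ℕ} (hk : n + n' = k) (hl : m + m' = l) (hq : p + p' = q)
    (f : Hom n m) (g : Hom m p) (f' : Hom n' m') (g' : Hom m' p') :
    tensor hk hq (comp f g) (comp f' g') = comp (tensor hk hl f f') (tensor hl hq g g')
  tensor_assoc {n₁ n₂ n₃ n₁₂ n₂₃ n m₁ m₂ m₃ m₁₂ m₂₃ m : ℕ}
    (hn₁₂ : n₁ + n₂ = n₁₂) (hn : n₁₂ + n₃ = n) (hn₂₃ : n₂ + n₃ = n₂₃) (hn' : n₁ + n₂₃ = n)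
    (hm₁₂ : m₁ + m₂ = m₁₂) (hm : m₁₂ + m₃ = m) (hm₂₃ : m₂ + m₃ = m₂₃) (hm' : m₁ + m₂₃ = m)
    (f : Hom n₁ m₁) (g : Hom n₂ m₂) (h : Hom n₃ m₃) :
    tensor hn hm (tensor hn₁₂ hm₁₂ f g) h = tensor hn' hm' f (tensor hn₂₃ hm₂₃ g h)
  unit_tensor {n m : ℕ} (hn : 0 + n = n) (hm : 0 + m = m) (f : Hom n m) :
    tensor hn hm (id 0) f = f
  tensor_unit {n m : ℕ} (hn : n + 0 = n) (hm : m + 0 = m) (f : Hom n m) :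
    tensor hn hm f (id 0) = f
  /-- Naturality of the symmetries. -/
  braid_natural {n m n' m' k k' l l' : ℕ} (hk : n + n' = k) (hk' : n' + n = k')
    (hl : m + m' = l) (hl' : m' + m = l') (f : Hom n m) (g : Hom n' m') :
    comp (tensor hk hl f g) (braid m m' hl hl') = comp (braid n n' hk hk') (tensor hk' hl' g f)
  /-- `σ_{m,n} ; σ_{n,m} = id`. -/
  braid_symm {m n k l : ℕ} (hk : m + n = k) (hl : n + m = l) :
    comp (braid m n hk hl) (braid n m hl hk) = id k
  /-- The hexagon law `σ_{m+n,p} = (id_m ⊕ σ_{n,p}) ; (σ_{m,p} ⊕ id_n)`. -/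
  hexagon {m n p mn np pn mp pm k l q : ℕ} (hmn : m + n = mn) (hnp : n + p = np)
    (hpn : p + n = pn) (hmp : m + p = mp) (hpm : p + m = pm)
    (hk : mn + p = k) (hk' : m + np = k) (hq : m + pn = q) (hq' : mp + n = q)
    (hl : p + mn = l) (hl' : pm + n = l) :
    braid mn p hk hl =
      comp (tensor hk' hq (id m) (braid n p hnp hpn)) (tensor hq' hl' (braid m p hmp hpm) (id n))

/-- Arrows of props: strict symmetric monoidal functors that are the identity on objects. -/
@[ext]
structure PROPMor (S S' : PROP.{u}) where
  map {n m : ℕ} : S.Hom n m → S'.Hom n m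
  map_id (n : ℕ) : map (S.id n) = S'.id n
  map_comp {n m k : ℕ} (f : S.Hom n m) (g : S.Hom m k) :
    map (S.comp f g) = S'.comp (map f) (map g)
  map_tensor {n n' k m m' l : ℕ} (hk : n + n' = k) (hl : m + m' = l)
    (f : S.Hom n m) (g : S.Hom n' m') :
    map (S.tensor hk hl f g) = S'.tensor hk hl (map f) (map g)
  map_braid (m n : ℕ) {k l : ℕ} (hk : m + n = k) (hl : n + m = l) :
    map (S.braid m n hk hl) = S'.braid m n hk hl

/-- The category of props. -/
instance : Category PROP.{u} where
  Hom := PROPMor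
  id S :=
    { map := fun f => f
      map_id := fun _ => rfl
      map_comp := fun _ _ => rfl
      map_tensor := fun _ _ _ _ => rfl
      map_braid := fun _ _ _ _ _ _ => rfl }
  comp F G :=
    { map := fun f => G.map (F.map f)
      map_id := fun n => by rw [F.map_id, G.map_id]
      map_comp := fun f g => by rw [F.map_comp, G.map_comp]
      map_tensor := fun hk hl f g => by rw [F.map_tensor, G.map_tensor]
      map_braid := fun m n _ _ hk hl => by rw [F.map_braid, G.map_braid] }

/-! ### Bijections in props -/

/-- Expressions built from identities and symmetries by sequential and parallel composition. -/
inductive SymWord : ℕ → ℕ → Type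
  | id (n : ℕ) : SymWord n n
  | comp {n m k : ℕ} (v : SymWord n m) (w : SymWord m k) : SymWord n k
  | tensor {n n' k m m' l : ℕ} (hk : n + n' = k) (hl : m + m' = l)
      (v : SymWord n m) (w : SymWord n' m') : SymWord k l
  | braid (m n : ℕ) {k l : ℕ} (hk : m + n = k) (hl : n + m = l) : SymWord k l

/-- The value of such an expression in a prop `P` (only the operations of `P` are used). -/
def SymWord.eval (P : PropSig.{u}) : {n m : ℕ} → SymWord n m → P.Hom n m
  | _, _, .id n => P.id n
  | _, _, .comp v w => P.comp (v.eval P) (w.eval P)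
  | _, _, .tensor hk hl v w => P.tensor hk hl (v.eval P) (w.eval P)
  | _, _, .braid m n hk hl => P.braid m n hk hl

/-- The operations of the prop of bijections between finite ordinals: parallel composition is
juxtaposition, and `σ_{m,n}` sends the `i`-th of the first `m` inputs to the output `n + i` and the
`j`-th of the last `n` inputs to the output `j`. -/
def bijSig : PropSig.{0} where
  Hom n m := Fin n ≃ Fin m
  id _ := Equiv.refl _
  comp e e' := e.trans e'
  tensor hk hl e e' :=
    (finCongr hk.symm).trans
      ((finSumFinEquiv.symm.trans ((Equiv.sumCongr e e').trans finSumFinEquiv)).trans (finCongr hl))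
  braid _ _ _ _ hk hl := (finCongr hk.symm).trans (finAddFlip.trans (finCongr hl))

/-- The bijection denoted by a word in the symmetries: input wire `i` is connected to output wire
`w.toEquiv i`. -/
def SymWord.toEquiv {n m : ℕ} (w : SymWord n m) : Fin n ≃ Fin m := w.eval bijSig

/-! ## Nominal props -/

variable {𝒩 : Type} [DecidableEq 𝒩]

/-- `C` is the disjoint union `A ⊎ A'`. -/
structure IsDisjUnion (A A' C : Finset 𝒩) : Prop where
  disjoint : Disjoint A A'
  union_eq : A ∪ A' = C

namespace IsDisjUnion

/-- The evident bijection between the disjoint sum of `A` and `A'` and `C = A ⊎ A'`. -/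
def sumEquiv {A A' C : Finset 𝒩} (h : IsDisjUnion A A' C) : A ⊕ A' ≃ C :=
  (Equiv.Finset.union A A' h.disjoint).trans
    (Equiv.subtypeEquivRight fun x => by rw [h.union_eq])

/-- The union `e ⊎ e'` of two bijections between disjoint sets. -/
def bij {A A' C B B' D : Finset 𝒩} (hC : IsDisjUnion A A' C) (hD : IsDisjUnion B B' D)
    (e : A ≃ B) (e' : A' ≃ B') : C ≃ D :=
  hC.sumEquiv.symm.trans ((Equiv.sumCongr e e').trans hD.sumEquiv)

/-- A list of pairwise distinct names of length `n` with underlying set `A` is the same thing as a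
bijection `Fin n ≃ A`. This is the concatenation `a + a'` of two such lists with disjoint
underlying sets. -/
def append {A A' C : Finset 𝒩} (h : IsDisjUnion A A' C) {n n' k : ℕ} (hk : n + n' = k)
    (a : Fin n ≃ A) (a' : Fin n' ≃ A') : Fin k ≃ C :=
  (finCongr hk.symm).trans
    (finSumFinEquiv.symm.trans ((Equiv.sumCongr a a').trans h.sumEquiv))

end IsDisjUnion

/-- The restriction `π_A : A → π · A` of a permutation `π` of names. -/
def permRestrict (π : Equiv.Perm 𝒩) (A : Finset 𝒩) : A ≃ A.map π.toEmbedding :=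
  π.subtypeEquiv fun a => by simp

variable (𝒩) in
/-- A nominal prop: a category whose objects are the finite sets of names, which contains all
bijections (`ren e` is the arrow given by the bijection `e`), and which has a partial commutative
tensor `f ⊎ g`, defined if the domains of `f` and `g` are disjoint and the codomains of `f` and `g`
are disjoint, extending the disjoint union of finite sets and of bijections. -/
structure NPROP where
  Hom : Finset 𝒩 → Finset 𝒩 → Type u
  id (A : Finset 𝒩) : Hom A A
  comp {A B C : Finset 𝒩} (f : Hom A B) (g : Hom B C) : Hom A C
  ren {A B : Finset 𝒩} (e : A ≃ B) : Hom A B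
  tensor {A A' C B B' D : Finset 𝒩} (hC : IsDisjUnion A A' C) (hD : IsDisjUnion B B' D)
    (f : Hom A B) (g : Hom A' B') : Hom C D
  id_comp {A B : Finset 𝒩} (f : Hom A B) : comp (id A) f = f
  comp_id {A B : Finset 𝒩} (f : Hom A B) : comp f (id B) = f
  assoc {A B C D : Finset 𝒩} (f : Hom A B) (g : Hom B C) (h : Hom C D) :
    comp (comp f g) h = comp f (comp g h)
  ren_refl (A : Finset 𝒩) : ren (Equiv.refl A) = id A
  ren_trans {A B C : Finset 𝒩} (e : A ≃ B) (e' : B ≃ C) :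
    ren (e.trans e') = comp (ren e) (ren e')
  ren_tensor {A A' C B B' D : Finset 𝒩} (hC : IsDisjUnion A A' C) (hD : IsDisjUnion B B' D)
    (e : A ≃ B) (e' : A' ≃ B') : tensor hC hD (ren e) (ren e') = ren (hC.bij hD e e')
  tensor_id {A A' C : Finset 𝒩} (hC : IsDisjUnion A A' C) :
    tensor hC hC (id A) (id A') = id C
  interchange {A A' P B B' Q C C' R : Finset 𝒩} (hP : IsDisjUnion A A' P)
    (hQ : IsDisjUnion B B' Q) (hR : IsDisjUnion C C' R)
    (f : Hom A B) (g : Hom B C) (f' : Hom A' B') (g' : Hom B' C') :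
    tensor hP hR (comp f g) (comp f' g') = comp (tensor hP hQ f f') (tensor hQ hR g g')
  tensor_assoc {A₁ A₂ A₃ A₁₂ A₂₃ A B₁ B₂ B₃ B₁₂ B₂₃ B : Finset 𝒩}
    (hA₁₂ : IsDisjUnion A₁ A₂ A₁₂) (hA : IsDisjUnion A₁₂ A₃ A)
    (hA₂₃ : IsDisjUnion A₂ A₃ A₂₃) (hA' : IsDisjUnion A₁ A₂₃ A)
    (hB₁₂ : IsDisjUnion B₁ B₂ B₁₂) (hB : IsDisjUnion B₁₂ B₃ B)
    (hB₂₃ : IsDisjUnion B₂ B₃ B₂₃) (hB' : IsDisjUnion B₁ B₂₃ B)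
    (f : Hom A₁ B₁) (g : Hom A₂ B₂) (h : Hom A₃ B₃) :
    tensor hA hB (tensor hA₁₂ hB₁₂ f g) h = tensor hA' hB' f (tensor hA₂₃ hB₂₃ g h)
  unit_tensor {A B : Finset 𝒩} (hA : IsDisjUnion ∅ A A) (hB : IsDisjUnion ∅ B B) (f : Hom A B) :
    tensor hA hB (id ∅) f = f
  tensor_unit {A B : Finset 𝒩} (hA : IsDisjUnion A ∅ A) (hB : IsDisjUnion B ∅ B) (f : Hom A B) :
    tensor hA hB f (id ∅) = f
  tensor_comm {A A' C B B' D : Finset 𝒩} (hC : IsDisjUnion A A' C) (hC' : IsDisjUnion A' A C)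
    (hD : IsDisjUnion B B' D) (hD' : IsDisjUnion B' B D) (f : Hom A B) (g : Hom A' B') :
    tensor hC hD f g = tensor hC' hD' g f

/-- The action of a permutation on the arrows of a nominal prop:
`π · f = (π_A)⁻¹ ; f ; π_B : π · A → π · B`. -/
def NPROP.act (T : NPROP.{u} 𝒩) (π : Equiv.Perm 𝒩) {A B : Finset 𝒩} (f : T.Hom A B) :
    T.Hom (A.map π.toEmbedding) (B.map π.toEmbedding) :=
  T.comp (T.ren (permRestrict π A).symm) (T.comp f (T.ren (permRestrict π B)))

/-- Arrows of nominal props: functors that are the identity on objects, strict monoidal and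
equivariant under all finite permutations of names. -/
@[ext]
structure NPROPMor (T T' : NPROP.{u} 𝒩) where
  map {A B : Finset 𝒩} : T.Hom A B → T'.Hom A B
  map_id (A : Finset 𝒩) : map (T.id A) = T'.id A
  map_comp {A B C : Finset 𝒩} (f : T.Hom A B) (g : T.Hom B C) :
    map (T.comp f g) = T'.comp (map f) (map g)
  map_tensor {A A' C B B' D : Finset 𝒩} (hC : IsDisjUnion A A' C) (hD : IsDisjUnion B B' D)
    (f : T.Hom A B) (g : T.Hom A' B') :
    map (T.tensor hC hD f g) = T'.tensor hC hD (map f) (map g)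
  map_act (π : Equiv.Perm 𝒩) (hπ : {x | π x ≠ x}.Finite) {A B : Finset 𝒩} (f : T.Hom A B) :
    map (T.act π f) = T'.act π (map f)

/-- The category of nominal props. -/
instance : Category (NPROP.{u} 𝒩) where
  Hom := NPROPMor
  id T :=
    { map := fun f => f
      map_id := fun _ => rfl
      map_comp := fun _ _ => rfl
      map_tensor := fun _ _ _ _ => rfl
      map_act := fun _ _ _ _ _ => rfl }
  comp F G :=
    { map := fun f => G.map (F.map f)
      map_id := fun A => by rw [F.map_id, G.map_id]
      map_comp := fun f g => by rw [F.map_comp, G.map_comp]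
      map_tensor := fun hC hD f g => by rw [F.map_tensor, G.map_tensor]
      map_act := fun π hπ _ _ f => by rw [F.map_act π hπ, G.map_act π hπ] }

/-! ### Arrows of nominal props preserve renamings -/

namespace NPROP

variable (T : NPROP.{u} 𝒩)

theorem ren_symm_comp {A B : Finset 𝒩} (e : A ≃ B) : T.comp (T.ren e.symm) (T.ren e) = T.id B := by
  rw [← T.ren_trans, Equiv.symm_trans_self, T.ren_refl]

theorem ren_comp_symm {A B : Finset 𝒩} (e : A ≃ B) : T.comp (T.ren e) (T.ren e.symm) = T.id A := by
  rw [← T.ren_trans, Equiv.self_trans_symm, T.ren_refl]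

end NPROP

theorem exists_perm_extending {A B : Finset 𝒩} (e : A ≃ B) :
    ∃ π : Equiv.Perm 𝒩, {x | π x ≠ x}.Finite ∧ ∀ x : A, π x = e x := by
  let U : Finset 𝒩 := A ∪ B
  let i : A ≃ {x : U // (x : 𝒩) ∈ A} :=
    { toFun := fun x => ⟨⟨x, Finset.mem_union_left _ x.2⟩, x.2⟩
      invFun := fun x => ⟨x.1, x.2⟩
      left_inv := fun _ => rfl
      right_inv := fun _ => rfl }
  let j : B ≃ {x : U // (x : 𝒩) ∈ B} :=
    { toFun := fun x => ⟨⟨x, Finset.mem_union_right _ x.2⟩, x.2⟩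
      invFun := fun x => ⟨x.1, x.2⟩
      left_inv := fun _ => rfl
      right_inv := fun _ => rfl }
  let e' : {x : U // (x : 𝒩) ∈ A} ≃ {x : U // (x : 𝒩) ∈ B} := (i.symm.trans e).trans j
  refine ⟨Equiv.Perm.ofSubtype (p := fun x => x ∈ U) e'.extendSubtype, ?_, ?_⟩
  · refine (U.finite_toSet).subset fun x hx => ?_
    by_contra h
    exact hx (Equiv.Perm.ofSubtype_apply_of_not_mem _ h)
  · intro x
    have hx : (x : 𝒩) ∈ U := Finset.mem_union_left _ x.2
    rw [Equiv.Perm.ofSubtype_apply_of_mem (p := fun x => x ∈ U) _ hx,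
      e'.extendSubtype_apply_of_mem _ x.2]
    rfl

namespace NPROPMor

variable {T T' : NPROP.{u} 𝒩} (F : NPROPMor T T')

theorem map_ren_of_fixed {A B : Finset 𝒩} (e : A ≃ B) (h : ∀ x : A, (e x : 𝒩) = x) :
    F.map (T.ren e) = T'.ren e := by
  have hAB : A = B := by
    ext x
    constructor
    · intro hx
      have := (e ⟨x, hx⟩).2
      rwa [h] at this
    · intro hx
      have h1 := h (e.symm ⟨x, hx⟩)
      rw [Equiv.apply_symm_apply] at h1
      have h2 := (e.symm ⟨x, hx⟩).2
      rwa [← h1] at h2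
  subst hAB
  have he : e = Equiv.refl A := Equiv.ext fun x => Subtype.ext (h x)
  rw [he, T.ren_refl, T'.ren_refl, F.map_id]

theorem map_ren_renaming [Infinite 𝒩] (π : Equiv.Perm 𝒩) (hπ : {x | π x ≠ x}.Finite)
    (B : Finset 𝒩) : F.map (T.ren (permRestrict π B)) = T'.ren (permRestrict π B) := by
  -- a set `A` of names fixed by `π`, with a bijection `f : A ≃ B`
  obtain ⟨A, hA, hcard⟩ : ∃ A : Finset 𝒩, (A : Set 𝒩) ⊆ {x | π x ≠ x}ᶜ ∧ A.card = B.card :=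
    hπ.infinite_compl.exists_subset_card_eq _
  have f : A ≃ B := Finset.equivOfCardEq hcard
  have hfix : ∀ x : A, (permRestrict π A x : 𝒩) = x := fun x => by
    have := hA x.2
    simpa [permRestrict] using this
  have h₁ : F.map (T.ren (permRestrict π A).symm) = T'.ren (permRestrict π A).symm := by
    refine F.map_ren_of_fixed _ fun x => ?_
    have := hfix ((permRestrict π A).symm x)
    rw [Equiv.apply_symm_apply] at this
    exact this.symm
  have h₂ := F.map_act π hπ (T.ren f)
  unfold NPROP.act at h₂
  rw [F.map_comp, F.map_comp, h₁] at h₂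
  have h₃ := congrArg (T'.comp (T'.ren (permRestrict π A))) h₂
  rw [← T'.assoc, ← T'.assoc (T'.ren (permRestrict π A)), T'.ren_comp_symm, T'.id_comp,
    T'.id_comp] at h₃
  have h₄ := congrArg (T'.comp (F.map (T.ren f.symm))) h₃
  rwa [← T'.assoc, ← T'.assoc, ← F.map_comp, T.ren_symm_comp, F.map_id, T'.id_comp,
    T'.id_comp] at h₄

/-- Arrows of nominal props preserve all renamings. -/
theorem map_ren [Infinite 𝒩] {A B : Finset 𝒩} (e : A ≃ B) : F.map (T.ren e) = T'.ren e := by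
  obtain ⟨π, hπ, he⟩ := exists_perm_extending e
  have h : e = (permRestrict π A).trans ((permRestrict π A).symm.trans e) := by
    ext x; simp
  rw [h, T.ren_trans, T'.ren_trans, F.map_comp, F.map_ren_renaming π hπ,
    F.map_ren_of_fixed]
  intro x
  obtain ⟨y, rfl⟩ := (permRestrict π A).surjective x
  rw [Equiv.trans_apply, Equiv.symm_apply_apply, ← he]
  rfl

end NPROPMor

/-! ## The functor `NOM` -/

namespace NOM

variable (𝒩) in
/-- Terms of the nominal prop presented by a prop `S`. The generators are the symbols `[a⟩ f ⟨b]`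
for all arrows `f : n → m` of `S` and all lists `a`, `b` of pairwise distinct names of lengths `n`
and `m`; the type of such a generator is given by the underlying sets of `a` and `b`. -/
inductive Term (S : PROP.{u}) : Finset 𝒩 → Finset 𝒩 → Type u
  | gen {n m : ℕ} {A B : Finset 𝒩} (a : Fin n ≃ A) (b : Fin m ≃ B) (f : S.Hom n m) : Term S A B
  | id (A : Finset 𝒩) : Term S A A
  | ren {A B : Finset 𝒩} (e : A ≃ B) : Term S A B
  | comp {A B C : Finset 𝒩} (t : Term S A B) (s : Term S B C) : Term S A C
  | tensor {A A' C B B' D : Finset 𝒩} (hC : IsDisjUnion A A' C) (hD : IsDisjUnion B B' D)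
      (t : Term S A B) (s : Term S A' B') : Term S C D

/-- The smallest congruence on terms that contains the laws of nominal props and the five defining
equations of `NOM(S)` (the constructors whose names begin with `gen`). For lists `a`, `b` of the
same length, `[a|b]` is the renaming `a_i ↦ b_i`, that is, `ren (a.symm.trans b)`. For lists `b`,
`b'` with the same underlying set, `⟨b|b'⟩` is the symmetry with `i ↦ j` if `b_i = b'_j`, that is,
with underlying bijection `b.trans b'.symm`. -/
inductive Rel (S : PROP.{u}) : {A B : Finset 𝒩} → Term 𝒩 S A B → Term 𝒩 S A B → Prop
  | refl {A B : Finset 𝒩} (t : Term 𝒩 S A B) : Rel S t t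
  | symm {A B : Finset 𝒩} {t s : Term 𝒩 S A B} (h : Rel S t s) : Rel S s t
  | trans {A B : Finset 𝒩} {t s r : Term 𝒩 S A B} (h : Rel S t s) (h' : Rel S s r) : Rel S t r
  | comp_congr {A B C : Finset 𝒩} {t t' : Term 𝒩 S A B} {s s' : Term 𝒩 S B C}
      (h : Rel S t t') (h' : Rel S s s') : Rel S (.comp t s) (.comp t' s')
  | tensor_congr {A A' C B B' D : Finset 𝒩} (hC : IsDisjUnion A A' C) (hD : IsDisjUnion B B' D)
      {t t' : Term 𝒩 S A B} {s s' : Term 𝒩 S A' B'} (h : Rel S t t') (h' : Rel S s s') :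
      Rel S (.tensor hC hD t s) (.tensor hC hD t' s')
  | id_comp {A B : Finset 𝒩} (t : Term 𝒩 S A B) : Rel S (.comp (.id A) t) t
  | comp_id {A B : Finset 𝒩} (t : Term 𝒩 S A B) : Rel S (.comp t (.id B)) t
  | assoc {A B C D : Finset 𝒩} (t : Term 𝒩 S A B) (s : Term 𝒩 S B C) (r : Term 𝒩 S C D) :
      Rel S (.comp (.comp t s) r) (.comp t (.comp s r))
  | ren_refl (A : Finset 𝒩) : Rel S (.ren (Equiv.refl A)) (.id A)
  | ren_trans {A B C : Finset 𝒩} (e : A ≃ B) (e' : B ≃ C) :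
      Rel S (.ren (e.trans e')) (.comp (.ren e) (.ren e'))
  | ren_tensor {A A' C B B' D : Finset 𝒩} (hC : IsDisjUnion A A' C) (hD : IsDisjUnion B B' D)
      (e : A ≃ B) (e' : A' ≃ B') :
      Rel S (.tensor hC hD (.ren e) (.ren e')) (.ren (hC.bij hD e e'))
  | tensor_id {A A' C : Finset 𝒩} (hC : IsDisjUnion A A' C) :
      Rel S (.tensor hC hC (.id A) (.id A')) (.id C)
  | interchange {A A' P B B' Q C C' R : Finset 𝒩} (hP : IsDisjUnion A A' P)
      (hQ : IsDisjUnion B B' Q) (hR : IsDisjUnion C C' R)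
      (t : Term 𝒩 S A B) (s : Term 𝒩 S B C) (t' : Term 𝒩 S A' B') (s' : Term 𝒩 S B' C') :
      Rel S (.tensor hP hR (.comp t s) (.comp t' s'))
        (.comp (.tensor hP hQ t t') (.tensor hQ hR s s'))
  | tensor_assoc {A₁ A₂ A₃ A₁₂ A₂₃ A B₁ B₂ B₃ B₁₂ B₂₃ B : Finset 𝒩}
      (hA₁₂ : IsDisjUnion A₁ A₂ A₁₂) (hA : IsDisjUnion A₁₂ A₃ A)
      (hA₂₃ : IsDisjUnion A₂ A₃ A₂₃) (hA' : IsDisjUnion A₁ A₂₃ A)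
      (hB₁₂ : IsDisjUnion B₁ B₂ B₁₂) (hB : IsDisjUnion B₁₂ B₃ B)
      (hB₂₃ : IsDisjUnion B₂ B₃ B₂₃) (hB' : IsDisjUnion B₁ B₂₃ B)
      (t : Term 𝒩 S A₁ B₁) (s : Term 𝒩 S A₂ B₂) (r : Term 𝒩 S A₃ B₃) :
      Rel S (.tensor hA hB (.tensor hA₁₂ hB₁₂ t s) r) (.tensor hA' hB' t (.tensor hA₂₃ hB₂₃ s r))
  | unit_tensor {A B : Finset 𝒩} (hA : IsDisjUnion ∅ A A) (hB : IsDisjUnion ∅ B B)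
      (t : Term 𝒩 S A B) : Rel S (.tensor hA hB (.id ∅) t) t
  | tensor_unit {A B : Finset 𝒩} (hA : IsDisjUnion A ∅ A) (hB : IsDisjUnion B ∅ B)
      (t : Term 𝒩 S A B) : Rel S (.tensor hA hB t (.id ∅)) t
  | tensor_comm {A A' C B B' D : Finset 𝒩} (hC : IsDisjUnion A A' C) (hC' : IsDisjUnion A' A C)
      (hD : IsDisjUnion B B' D) (hD' : IsDisjUnion B' B D)
      (t : Term 𝒩 S A B) (s : Term 𝒩 S A' B') :
      Rel S (.tensor hC hD t s) (.tensor hC' hD' s t)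
  /-- `[a⟩ f;g ⟨c] = [a⟩ f ⟨b] ; [b⟩ g ⟨c]` -/
  | gen_comp {n m k : ℕ} {A B C : Finset 𝒩} (a : Fin n ≃ A) (b : Fin m ≃ B) (c : Fin k ≃ C)
      (f : S.Hom n m) (g : S.Hom m k) :
      Rel S (.gen a c (S.comp f g)) (.comp (.gen a b f) (.gen b c g))
  /-- `[a + c⟩ f⊕g ⟨b + d] = [a⟩ f ⟨b] ⊎ [c⟩ g ⟨d]` -/
  | gen_tensor {n n' k m m' l : ℕ} (hk : n + n' = k) (hl : m + m' = l)
      {A A' C B B' D : Finset 𝒩} (hC : IsDisjUnion A A' C) (hD : IsDisjUnion B B' D)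
      (a : Fin n ≃ A) (c : Fin n' ≃ A') (b : Fin m ≃ B) (d : Fin m' ≃ B')
      (f : S.Hom n m) (g : S.Hom n' m') :
      Rel S (.gen (hC.append hk a c) (hD.append hl b d) (S.tensor hk hl f g))
        (.tensor hC hD (.gen a b f) (.gen c d g))
  /-- `[a⟩ id ⟨b] = [a|b]` -/
  | gen_id {n : ℕ} {A B : Finset 𝒩} (a : Fin n ≃ A) (b : Fin n ≃ B) :
      Rel S (.gen a b (S.id n)) (.ren (a.symm.trans b))
  /-- `[a⟩ ⟨b|b'⟩;f ⟨c] = [a|b] ; [b'⟩ f ⟨c]` -/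
  | gen_symm_comp {n m : ℕ} {A B C : Finset 𝒩} (a : Fin n ≃ A) (b b' : Fin n ≃ B)
      (c : Fin m ≃ C) (f : S.Hom n m) (w : SymWord n n) (hw : w.toEquiv = b.trans b'.symm) :
      Rel S (.gen a c (S.comp (w.eval S.toPropSig) f)) (.comp (.ren (a.symm.trans b)) (.gen b' c f))
  /-- `[a⟩ f;⟨b|b'⟩ ⟨c] = [a⟩ f ⟨b] ; [b'|c]` -/
  | gen_comp_symm {n m : ℕ} {A B C : Finset 𝒩} (a : Fin n ≃ A) (b b' : Fin m ≃ B)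
      (c : Fin m ≃ C) (f : S.Hom n m) (w : SymWord m m) (hw : w.toEquiv = b.trans b'.symm) :
      Rel S (.gen a c (S.comp f (w.eval S.toPropSig))) (.comp (.gen a b f) (.ren (b'.symm.trans c)))

variable (𝒩) in
/-- The nominal prop `NOM(S)`: terms modulo the equations. -/
def obj (S : PROP.{u}) : NPROP.{u} 𝒩 where
  Hom A B := Quot (Rel S (A := A) (B := B))
  id A := Quot.mk _ (.id A)
  comp := Quot.map₂ Term.comp (fun t _ _ h => .comp_congr (.refl t) h)
    (fun _ _ s h => .comp_congr h (.refl s))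
  ren e := Quot.mk _ (.ren e)
  tensor hC hD := Quot.map₂ (Term.tensor hC hD) (fun t _ _ h => .tensor_congr hC hD (.refl t) h)
    (fun _ _ s h => .tensor_congr hC hD h (.refl s))
  id_comp := by rintro _ _ ⟨t⟩; exact Quot.sound (.id_comp t)
  comp_id := by rintro _ _ ⟨t⟩; exact Quot.sound (.comp_id t)
  assoc := by rintro _ _ _ _ ⟨t⟩ ⟨s⟩ ⟨r⟩; exact Quot.sound (.assoc t s r)
  ren_refl A := Quot.sound (.ren_refl A)
  ren_trans e e' := Quot.sound (.ren_trans e e')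
  ren_tensor hC hD e e' := Quot.sound (.ren_tensor hC hD e e')
  tensor_id hC := Quot.sound (.tensor_id hC)
  interchange := by
    rintro _ _ _ _ _ _ _ _ _ hP hQ hR ⟨t⟩ ⟨s⟩ ⟨t'⟩ ⟨s'⟩
    exact Quot.sound (.interchange hP hQ hR t s t' s')
  tensor_assoc := by
    rintro _ _ _ _ _ _ _ _ _ _ _ _ h₁ h₂ h₃ h₄ h₅ h₆ h₇ h₈ ⟨t⟩ ⟨s⟩ ⟨r⟩
    exact Quot.sound (.tensor_assoc h₁ h₂ h₃ h₄ h₅ h₆ h₇ h₈ t s r)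
  unit_tensor := by rintro _ _ hA hB ⟨t⟩; exact Quot.sound (.unit_tensor hA hB t)
  tensor_unit := by rintro _ _ hA hB ⟨t⟩; exact Quot.sound (.tensor_unit hA hB t)
  tensor_comm := by
    rintro _ _ _ _ _ _ hC hC' hD hD' ⟨t⟩ ⟨s⟩
    exact Quot.sound (.tensor_comm hC hC' hD hD' t s)

/-- The arrow `[a⟩ f ⟨b]` of `NOM(S)`. -/
def arr {S : PROP.{u}} {n m : ℕ} {A B : Finset 𝒩} (a : Fin n ≃ A) (b : Fin m ≃ B)
    (f : S.Hom n m) : (obj 𝒩 S).Hom A B :=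
  Quot.mk _ (.gen a b f)

end NOM

theorem PROPMor.map_eval {S S' : PROP.{u}} (F : PROPMor S S') {n m : ℕ} (w : SymWord n m) :
    F.map (w.eval S.toPropSig) = w.eval S'.toPropSig := by
  induction w with
  | id n => exact F.map_id n
  | comp v w hv hw => simp only [SymWord.eval]; rw [F.map_comp, hv, hw]
  | tensor hk hl v w hv hw => simp only [SymWord.eval]; rw [F.map_tensor, hv, hw]
  | braid m n hk hl => exact F.map_braid m n hk hl

namespace NOM

/-- The action of an arrow of props on terms, replacing every `[a⟩ f ⟨b]` by `[a⟩ F f ⟨b]`. -/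
def mapTerm {S S' : PROP.{u}} (F : PROPMor S S') :
    {A B : Finset 𝒩} → Term 𝒩 S A B → Term 𝒩 S' A B
  | _, _, .gen a b f => .gen a b (F.map f)
  | _, _, .id A => .id A
  | _, _, .ren e => .ren e
  | _, _, .comp t s => .comp (mapTerm F t) (mapTerm F s)
  | _, _, .tensor hC hD t s => .tensor hC hD (mapTerm F t) (mapTerm F s)

theorem mapTerm_rel {S S' : PROP.{u}} (F : PROPMor S S') {A B : Finset 𝒩} {t s : Term 𝒩 S A B}
    (h : Rel S t s) : Rel S' (mapTerm F t) (mapTerm F s) := by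
  induction h with
  | refl t => exact .refl _
  | symm _ ih => exact .symm ih
  | trans _ _ ih ih' => exact .trans ih ih'
  | comp_congr _ _ ih ih' => exact .comp_congr ih ih'
  | tensor_congr hC hD _ _ ih ih' => exact .tensor_congr hC hD ih ih'
  | id_comp t => exact .id_comp _
  | comp_id t => exact .comp_id _
  | assoc t s r => exact .assoc _ _ _
  | ren_refl A => exact .ren_refl A
  | ren_trans e e' => exact .ren_trans e e'
  | ren_tensor hC hD e e' => exact .ren_tensor hC hD e e'
  | tensor_id hC => exact .tensor_id hC
  | interchange hP hQ hR t s t' s' => exact .interchange hP hQ hR _ _ _ _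
  | tensor_assoc h₁ h₂ h₃ h₄ h₅ h₆ h₇ h₈ t s r =>
    exact .tensor_assoc h₁ h₂ h₃ h₄ h₅ h₆ h₇ h₈ _ _ _
  | unit_tensor hA hB t => exact .unit_tensor hA hB _
  | tensor_unit hA hB t => exact .tensor_unit hA hB _
  | tensor_comm hC hC' hD hD' t s => exact .tensor_comm hC hC' hD hD' _ _
  | gen_comp a b c f g => simp only [mapTerm, F.map_comp]; exact .gen_comp a b c _ _
  | gen_tensor hk hl hC hD a c b d f g =>
    simp only [mapTerm, F.map_tensor]; exact .gen_tensor hk hl hC hD a c b d _ _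
  | gen_id a b => simp only [mapTerm, F.map_id]; exact .gen_id a b
  | gen_symm_comp a b b' c f w hw =>
    simp only [mapTerm, F.map_comp, F.map_eval]; exact .gen_symm_comp a b b' c _ w hw
  | gen_comp_symm a b b' c f w hw =>
    simp only [mapTerm, F.map_comp, F.map_eval]; exact .gen_comp_symm a b b' c _ w hw

/-- The arrow `NOM(F) : NOM(S) → NOM(S')` with `NOM(F)([a⟩ f ⟨b]) = [a⟩ F f ⟨b]`. -/
def map {S S' : PROP.{u}} (F : PROPMor S S') : NPROPMor (obj 𝒩 S) (obj 𝒩 S') where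
  map := Quot.map (mapTerm F) fun _ _ h => mapTerm_rel F h
  map_id _ := rfl
  map_comp := by rintro _ _ _ ⟨t⟩ ⟨s⟩; rfl
  map_tensor := by rintro _ _ _ _ _ _ hC hD ⟨t⟩ ⟨s⟩; rfl
  map_act := by rintro π hπ _ _ ⟨t⟩; rfl

theorem mapTerm_id {S : PROP.{u}} {A B : Finset 𝒩} (t : Term 𝒩 S A B) :
    mapTerm (𝟙 S : S ⟶ S) t = t := by
  induction t with
  | gen a b f => rfl
  | id A => rfl
  | ren e => rfl
  | comp t s ht hs => simp only [mapTerm, ht, hs]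
  | tensor hC hD t s ht hs => simp only [mapTerm, ht, hs]

theorem mapTerm_comp {S S' S'' : PROP.{u}} (F : S ⟶ S') (G : S' ⟶ S'') {A B : Finset 𝒩}
    (t : Term 𝒩 S A B) : mapTerm (F ≫ G) t = mapTerm G (mapTerm F t) := by
  induction t with
  | gen a b f => rfl
  | id A => rfl
  | ren e => rfl
  | comp t s ht hs => simp only [mapTerm, ht, hs]
  | tensor hC hD t s ht hs => simp only [mapTerm, ht, hs]

end NOM

variable (𝒩) in
/-- The functor `NOM` from props to nominal props. -/
def NOM : PROP.{u} ⥤ NPROP.{u} 𝒩 where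
  obj S := NOM.obj 𝒩 S
  map F := NOM.map F
  map_id S := by
    apply NPROPMor.ext
    funext A B t
    induction t using Quot.ind with
    | mk t => exact congrArg (Quot.mk _) (NOM.mapTerm_id t)
  map_comp F G := by
    apply NPROPMor.ext
    funext A B t
    induction t using Quot.ind with
    | mk t => exact congrArg (Quot.mk _) (NOM.mapTerm_comp F G t)

/-! ## The functor `ORD` -/

namespace ORD

/-- Terms of the prop presented by a nominal prop `T`. The generators are the symbols `⟨a] f [b⟩`
for all arrows `f : A → B` of `T` and all lists `a`, `b` of pairwise distinct names with underlying
sets `A` and `B`; the type of such a generator is given by the lengths of `a` and `b`. -/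
inductive Term (T : NPROP.{u} 𝒩) : ℕ → ℕ → Type u
  | gen {n m : ℕ} {A B : Finset 𝒩} (a : Fin n ≃ A) (b : Fin m ≃ B) (f : T.Hom A B) : Term T n m
  | id (n : ℕ) : Term T n n
  | comp {n m k : ℕ} (t : Term T n m) (s : Term T m k) : Term T n k
  | tensor {n n' k m m' l : ℕ} (hk : n + n' = k) (hl : m + m' = l)
      (t : Term T n m) (s : Term T n' m') : Term T k l
  | braid (m n : ℕ) {k l : ℕ} (hk : m + n = k) (hl : n + m = l) : Term T k l

/-- The operations on terms. -/
def termSig (T : NPROP.{u} 𝒩) : PropSig.{u} where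
  Hom := Term T
  id := .id
  comp := .comp
  tensor := .tensor
  braid := .braid

/-- The smallest congruence on terms that contains the laws of props and the five defining equations
of `ORD(T)` (the constructors whose names begin with `gen`). As above, `[b|c]` is
`ren (b.symm.trans c)`, and `⟨a|a'⟩` is the symmetry with underlying bijection `a.trans a'.symm`. -/
inductive Rel (T : NPROP.{u} 𝒩) : {n m : ℕ} → Term T n m → Term T n m → Prop
  | refl {n m : ℕ} (t : Term T n m) : Rel T t t
  | symm {n m : ℕ} {t s : Term T n m} (h : Rel T t s) : Rel T s t
  | trans {n m : ℕ} {t s r : Term T n m} (h : Rel T t s) (h' : Rel T s r) : Rel T t r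
  | comp_congr {n m k : ℕ} {t t' : Term T n m} {s s' : Term T m k}
      (h : Rel T t t') (h' : Rel T s s') : Rel T (.comp t s) (.comp t' s')
  | tensor_congr {n n' k m m' l : ℕ} (hk : n + n' = k) (hl : m + m' = l)
      {t t' : Term T n m} {s s' : Term T n' m'} (h : Rel T t t') (h' : Rel T s s') :
      Rel T (.tensor hk hl t s) (.tensor hk hl t' s')
  | id_comp {n m : ℕ} (t : Term T n m) : Rel T (.comp (.id n) t) t
  | comp_id {n m : ℕ} (t : Term T n m) : Rel T (.comp t (.id m)) t
  | assoc {n m k l : ℕ} (t : Term T n m) (s : Term T m k) (r : Term T k l) :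
      Rel T (.comp (.comp t s) r) (.comp t (.comp s r))
  | tensor_id {n n' k : ℕ} (hk : n + n' = k) : Rel T (.tensor hk hk (.id n) (.id n')) (.id k)
  | interchange {n m p n' m' p' k l q : ℕ} (hk : n + n' = k) (hl : m + m' = l) (hq : p + p' = q)
      (t : Term T n m) (s : Term T m p) (t' : Term T n' m') (s' : Term T m' p') :
      Rel T (.tensor hk hq (.comp t s) (.comp t' s'))
        (.comp (.tensor hk hl t t') (.tensor hl hq s s'))
  | tensor_assoc {n₁ n₂ n₃ n₁₂ n₂₃ n m₁ m₂ m₃ m₁₂ m₂₃ m : ℕ}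
      (hn₁₂ : n₁ + n₂ = n₁₂) (hn : n₁₂ + n₃ = n) (hn₂₃ : n₂ + n₃ = n₂₃) (hn' : n₁ + n₂₃ = n)
      (hm₁₂ : m₁ + m₂ = m₁₂) (hm : m₁₂ + m₃ = m) (hm₂₃ : m₂ + m₃ = m₂₃) (hm' : m₁ + m₂₃ = m)
      (t : Term T n₁ m₁) (s : Term T n₂ m₂) (r : Term T n₃ m₃) :
      Rel T (.tensor hn hm (.tensor hn₁₂ hm₁₂ t s) r) (.tensor hn' hm' t (.tensor hn₂₃ hm₂₃ s r))
  | unit_tensor {n m : ℕ} (hn : 0 + n = n) (hm : 0 + m = m) (t : Term T n m) :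
      Rel T (.tensor hn hm (.id 0) t) t
  | tensor_unit {n m : ℕ} (hn : n + 0 = n) (hm : m + 0 = m) (t : Term T n m) :
      Rel T (.tensor hn hm t (.id 0)) t
  | braid_natural {n m n' m' k k' l l' : ℕ} (hk : n + n' = k) (hk' : n' + n = k')
      (hl : m + m' = l) (hl' : m' + m = l') (t : Term T n m) (s : Term T n' m') :
      Rel T (.comp (.tensor hk hl t s) (.braid m m' hl hl'))
        (.comp (.braid n n' hk hk') (.tensor hk' hl' s t))
  | braid_symm {m n k l : ℕ} (hk : m + n = k) (hl : n + m = l) :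
      Rel T (.comp (.braid m n hk hl) (.braid n m hl hk)) (.id k)
  | hexagon {m n p mn np pn mp pm k l q : ℕ} (hmn : m + n = mn) (hnp : n + p = np)
      (hpn : p + n = pn) (hmp : m + p = mp) (hpm : p + m = pm)
      (hk : mn + p = k) (hk' : m + np = k) (hq : m + pn = q) (hq' : mp + n = q)
      (hl : p + mn = l) (hl' : pm + n = l) :
      Rel T (.braid mn p hk hl)
        (.comp (.tensor hk' hq (.id m) (.braid n p hnp hpn))
          (.tensor hq' hl' (.braid m p hmp hpm) (.id n)))
  /-- `⟨a] f;g [c⟩ = ⟨a] f [b⟩ ; ⟨b] g [c⟩` -/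
  | gen_comp {n m k : ℕ} {A B C : Finset 𝒩} (a : Fin n ≃ A) (b : Fin m ≃ B) (c : Fin k ≃ C)
      (f : T.Hom A B) (g : T.Hom B C) :
      Rel T (.gen a c (T.comp f g)) (.comp (.gen a b f) (.gen b c g))
  /-- `⟨a + c] f⊎g [b + d⟩ = ⟨a] f [b⟩ ⊕ ⟨c] g [d⟩` -/
  | gen_tensor {n n' k m m' l : ℕ} (hk : n + n' = k) (hl : m + m' = l)
      {A A' C B B' D : Finset 𝒩} (hC : IsDisjUnion A A' C) (hD : IsDisjUnion B B' D)
      (a : Fin n ≃ A) (c : Fin n' ≃ A') (b : Fin m ≃ B) (d : Fin m' ≃ B')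
      (f : T.Hom A B) (g : T.Hom A' B') :
      Rel T (.gen (hC.append hk a c) (hD.append hl b d) (T.tensor hC hD f g))
        (.tensor hk hl (.gen a b f) (.gen c d g))
  /-- `⟨a] id [a⟩ = id` -/
  | gen_id {n : ℕ} {A : Finset 𝒩} (a : Fin n ≃ A) : Rel T (.gen a a (T.id A)) (.id n)
  /-- `⟨a] [a'|b];f [c⟩ = ⟨a|a'⟩ ; ⟨b] f [c⟩` -/
  | gen_ren_comp {n m : ℕ} {A B C : Finset 𝒩} (a a' : Fin n ≃ A) (b : Fin n ≃ B)
      (c : Fin m ≃ C) (f : T.Hom B C) (w : SymWord n n) (hw : w.toEquiv = a.trans a'.symm) :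
      Rel T (.gen a c (T.comp (T.ren (a'.symm.trans b)) f)) (.comp (w.eval (termSig T)) (.gen b c f))
  /-- `⟨a] f;[b|c] [c'⟩ = ⟨a] f [b⟩ ; ⟨c|c'⟩` -/
  | gen_comp_ren {n m : ℕ} {A B C : Finset 𝒩} (a : Fin n ≃ A) (b : Fin m ≃ B)
      (c c' : Fin m ≃ C) (f : T.Hom A B) (w : SymWord m m) (hw : w.toEquiv = c.trans c'.symm) :
      Rel T (.gen a c' (T.comp f (T.ren (b.symm.trans c)))) (.comp (.gen a b f) (w.eval (termSig T)))

/-- The prop `ORD(T)`: terms modulo the equations. -/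
def obj (T : NPROP.{u} 𝒩) : PROP.{u} where
  Hom n m := Quot (Rel T (n := n) (m := m))
  id n := Quot.mk _ (.id n)
  comp := Quot.map₂ Term.comp (fun t _ _ h => .comp_congr (.refl t) h)
    (fun _ _ s h => .comp_congr h (.refl s))
  tensor hk hl := Quot.map₂ (Term.tensor hk hl) (fun t _ _ h => .tensor_congr hk hl (.refl t) h)
    (fun _ _ s h => .tensor_congr hk hl h (.refl s))
  braid m n _ _ hk hl := Quot.mk _ (.braid m n hk hl)
  id_comp := by rintro _ _ ⟨t⟩; exact Quot.sound (.id_comp t)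
  comp_id := by rintro _ _ ⟨t⟩; exact Quot.sound (.comp_id t)
  assoc := by rintro _ _ _ _ ⟨t⟩ ⟨s⟩ ⟨r⟩; exact Quot.sound (.assoc t s r)
  tensor_id hk := Quot.sound (.tensor_id hk)
  interchange := by
    rintro _ _ _ _ _ _ _ _ _ hk hl hq ⟨t⟩ ⟨s⟩ ⟨t'⟩ ⟨s'⟩
    exact Quot.sound (.interchange hk hl hq t s t' s')
  tensor_assoc := by
    rintro _ _ _ _ _ _ _ _ _ _ _ _ h₁ h₂ h₃ h₄ h₅ h₆ h₇ h₈ ⟨t⟩ ⟨s⟩ ⟨r⟩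
    exact Quot.sound (.tensor_assoc h₁ h₂ h₃ h₄ h₅ h₆ h₇ h₈ t s r)
  unit_tensor := by rintro _ _ hn hm ⟨t⟩; exact Quot.sound (.unit_tensor hn hm t)
  tensor_unit := by rintro _ _ hn hm ⟨t⟩; exact Quot.sound (.tensor_unit hn hm t)
  braid_natural := by
    rintro _ _ _ _ _ _ _ _ hk hk' hl hl' ⟨t⟩ ⟨s⟩
    exact Quot.sound (.braid_natural hk hk' hl hl' t s)
  braid_symm hk hl := Quot.sound (.braid_symm hk hl)
  hexagon h₁ h₂ h₃ h₄ h₅ h₆ h₇ h₈ h₉ h₁₀ h₁₁ :=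
    Quot.sound (.hexagon h₁ h₂ h₃ h₄ h₅ h₆ h₇ h₈ h₉ h₁₀ h₁₁)

/-- The arrow `⟨a] f [b⟩` of `ORD(T)`. -/
def arr {T : NPROP.{u} 𝒩} {n m : ℕ} {A B : Finset 𝒩} (a : Fin n ≃ A) (b : Fin m ≃ B)
    (f : T.Hom A B) : (obj T).Hom n m :=
  Quot.mk _ (.gen a b f)

/-- The action of an arrow of nominal props on terms, replacing every `⟨a] f [b⟩` by
`⟨a] F f [b⟩`. -/
def mapTerm {T T' : NPROP.{u} 𝒩} (F : NPROPMor T T') : {n m : ℕ} → Term T n m → Term T' n m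
  | _, _, .gen a b f => .gen a b (F.map f)
  | _, _, .id n => .id n
  | _, _, .comp t s => .comp (mapTerm F t) (mapTerm F s)
  | _, _, .tensor hk hl t s => .tensor hk hl (mapTerm F t) (mapTerm F s)
  | _, _, .braid m n hk hl => .braid m n hk hl

theorem mapTerm_eval {T T' : NPROP.{u} 𝒩} (F : NPROPMor T T') {n m : ℕ} (w : SymWord n m) :
    mapTerm F (w.eval (termSig T)) = w.eval (termSig T') := by
  induction w with
  | id n => rfl
  | comp v w hv hw => exact congrArg₂ Term.comp hv hw
  | tensor hk hl v w hv hw => exact congrArg₂ (Term.tensor hk hl) hv hw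
  | braid m n hk hl => rfl

theorem mapTerm_rel [Infinite 𝒩] {T T' : NPROP.{u} 𝒩} (F : NPROPMor T T') {n m : ℕ}
    {t s : Term T n m} (h : Rel T t s) : Rel T' (mapTerm F t) (mapTerm F s) := by
  induction h with
  | refl t => exact .refl _
  | symm _ ih => exact .symm ih
  | trans _ _ ih ih' => exact .trans ih ih'
  | comp_congr _ _ ih ih' => exact .comp_congr ih ih'
  | tensor_congr hk hl _ _ ih ih' => exact .tensor_congr hk hl ih ih'
  | id_comp t => exact .id_comp _
  | comp_id t => exact .comp_id _
  | assoc t s r => exact .assoc _ _ _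
  | tensor_id hk => exact .tensor_id hk
  | interchange hk hl hq t s t' s' => exact .interchange hk hl hq _ _ _ _
  | tensor_assoc h₁ h₂ h₃ h₄ h₅ h₆ h₇ h₈ t s r =>
    exact .tensor_assoc h₁ h₂ h₃ h₄ h₅ h₆ h₇ h₈ _ _ _
  | unit_tensor hn hm t => exact .unit_tensor hn hm _
  | tensor_unit hn hm t => exact .tensor_unit hn hm _
  | braid_natural hk hk' hl hl' t s => exact .braid_natural hk hk' hl hl' _ _
  | braid_symm hk hl => exact .braid_symm hk hl
  | hexagon h₁ h₂ h₃ h₄ h₅ h₆ h₇ h₈ h₉ h₁₀ h₁₁ =>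
    exact .hexagon h₁ h₂ h₃ h₄ h₅ h₆ h₇ h₈ h₉ h₁₀ h₁₁
  | gen_comp a b c f g => simp only [mapTerm, F.map_comp]; exact .gen_comp a b c _ _
  | gen_tensor hk hl hC hD a c b d f g =>
    simp only [mapTerm, F.map_tensor]; exact .gen_tensor hk hl hC hD a c b d _ _
  | gen_id a => simp only [mapTerm, F.map_id]; exact .gen_id a
  | gen_ren_comp a a' b c f w hw =>
    simp only [mapTerm, F.map_comp, F.map_ren, mapTerm_eval]
    exact .gen_ren_comp a a' b c _ w hw
  | gen_comp_ren a b c c' f w hw =>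
    simp only [mapTerm, F.map_comp, F.map_ren, mapTerm_eval]
    exact .gen_comp_ren a b c c' _ w hw

/-- The arrow `ORD(F) : ORD(T) → ORD(T')` with `ORD(F)(⟨a] f [b⟩) = ⟨a] F f [b⟩`. -/
def map [Infinite 𝒩] {T T' : NPROP.{u} 𝒩} (F : NPROPMor T T') : PROPMor (obj T) (obj T') where
  map := Quot.map (mapTerm F) fun _ _ h => mapTerm_rel F h
  map_id _ := rfl
  map_comp := by rintro _ _ _ ⟨t⟩ ⟨s⟩; rfl
  map_tensor := by rintro _ _ _ _ _ _ hk hl ⟨t⟩ ⟨s⟩; rfl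
  map_braid _ _ _ _ _ _ := rfl

theorem mapTerm_id {T : NPROP.{u} 𝒩} {n m : ℕ} (t : Term T n m) :
    mapTerm (𝟙 T : T ⟶ T) t = t := by
  induction t with
  | gen a b f => rfl
  | id n => rfl
  | comp t s ht hs => simp only [mapTerm, ht, hs]
  | tensor hk hl t s ht hs => simp only [mapTerm, ht, hs]
  | braid m n hk hl => rfl

theorem mapTerm_comp {T T' T'' : NPROP.{u} 𝒩} (F : T ⟶ T') (G : T' ⟶ T'') {n m : ℕ}
    (t : Term T n m) : mapTerm (F ≫ G) t = mapTerm G (mapTerm F t) := by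
  induction t with
  | gen a b f => rfl
  | id n => rfl
  | comp t s ht hs => simp only [mapTerm, ht, hs]
  | tensor hk hl t s ht hs => simp only [mapTerm, ht, hs]
  | braid m n hk hl => rfl

end ORD

variable (𝒩) in
/-- The functor `ORD` from nominal props to props. -/
def ORD [Infinite 𝒩] : NPROP.{u} 𝒩 ⥤ PROP.{u} where
  obj T := ORD.obj T
  map F := ORD.map F
  map_id T := by
    apply PROPMor.ext
    funext n m t
    induction t using Quot.ind with
    | mk t => exact congrArg (Quot.mk _) (ORD.mapTerm_id t)
  map_comp F G := by
    apply PROPMor.ext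
    funext n m t
    induction t using Quot.ind with
    | mk t => exact congrArg (Quot.mk _) (ORD.mapTerm_comp F G t)

end

noncomputable section

/-! ## The prop of bijections -/

/-! The heart of the proof is that neither presentation creates or identifies arrows. For fixed
lists `a`, `b`, the assignment `f ↦ [a⟩ f ⟨b]` is a bijection from the arrows `n → m` of `S` to the
arrows `A → B` of `NOM(S)`. Dually, `f ↦ ⟨a] f [b⟩` is a bijection from the arrows of `T` to those
of `ORD(T)`. These are `NOM.arr_bijective` and `ORD.arr_bijective`.

For surjectivity, the defining equations, read from right to left, merge identities, bijections,
composites and tensors into a single generator with prescribed lists (`exists_arr_eq`). For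
injectivity, the presentation is interpreted in a concrete model. The model of `NOM(S)` has the
arrows `|A| → |B|` of `S` as its arrows `A → B`. The model of `ORD(T)` has as arrows `n → m` the
arrows of `T` between chosen sets of `n` and `m` names. A generator can be recovered from its value
in the model by taking coordinates in `a` and `b`.

Both arguments rest on coherence for symmetries (`SymWord.eval_congr`): in any prop, a word in the
symmetries depends only on its underlying bijection, so that every bijection denotes an arrow
`PROP.perm`. To prove this, words are brought into an insertion-sort normal form, in which wire 0 is
placed after the other wires have been sorted. The computation takes place in the product of the
given prop with the prop of bijections, where a normal form can be read off from its bijection.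

The unit and the inverse of the counit are then composites of two such bijections, hence
isomorphisms. They do not depend on the lists, because a change of lists inside cancels against the
same change outside. Working with the inverse of the counit avoids defining a map out of a presented
nominal prop. One triangle identity, checked on generators, completes the adjoint equivalence. -/

/-- The number of the output wire to which the input wire `i` is connected. -/
def wire {n m : ℕ} (e : bijSig.Hom n m) (i : Fin n) : Fin m := Equiv.toFun e i

/-- It reduces every law of `bijPROP` to arithmetic, by cases on the block in which a wire lies. -/
theorem wire_ext {n m : ℕ} {e e' : bijSig.Hom n m}
    (h : ∀ i, (wire e i : ℕ) = wire e' i) : e = e' :=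
  Equiv.ext fun i => Fin.ext (h i)

theorem wire_id (n : ℕ) (i : Fin n) : wire (bijSig.id n) i = i := rfl

theorem wire_comp {n m k : ℕ} (e : bijSig.Hom n m) (e' : bijSig.Hom m k) (i : Fin n) :
    wire (bijSig.comp e e') i = wire e' (wire e i) := rfl

theorem wire_tensor {n n' k m m' l : ℕ} (hk : n + n' = k) (hl : m + m' = l)
    (e : bijSig.Hom n m) (e' : bijSig.Hom n' m') (i : Fin k) :
    (wire (bijSig.tensor hk hl e e') i : ℕ) =
      if h : (i : ℕ) < n then (wire e ⟨i, h⟩ : ℕ) else m + (wire e' ⟨i - n, by omega⟩ : ℕ) := by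
  subst hk hl
  refine Fin.addCases (fun j => ?_) (fun j => ?_) i
  · have hj : ((Fin.castAdd n' j : Fin (n + n')) : ℕ) < n := j.2
    rw [dif_pos hj]
    simp only [wire, bijSig, finCongr_refl, Equiv.trans_refl, Equiv.refl_trans, Equiv.toFun_as_coe,
      Equiv.trans_apply, finSumFinEquiv_symm_apply_castAdd]
    exact congrArg Fin.val (finSumFinEquiv_apply_left _)
  · simp only [wire, bijSig, finCongr_refl, Equiv.trans_refl, Equiv.refl_trans, Equiv.toFun_as_coe,
      Equiv.trans_apply, finSumFinEquiv_symm_apply_natAdd]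
    refine (congrArg Fin.val (finSumFinEquiv_apply_right _)).trans ?_
    simp
    rfl

theorem wire_braid (m n : ℕ) {k l : ℕ} (hk : m + n = k) (hl : n + m = l) (i : Fin k) :
    (wire (bijSig.braid m n hk hl) i : ℕ) = if (i : ℕ) < m then n + i else i - m := by
  subst hk hl
  refine Fin.addCases (fun j => ?_) (fun j => ?_) i
  · simp [bijSig, wire]
  · simp [bijSig, wire]

theorem wire_congr {n m : ℕ} (e : bijSig.Hom n m) {i j : Fin n} (h : (i : ℕ) = j) :
    (wire e i : ℕ) = wire e j := by rw [Fin.ext h]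

/-- The prop of bijections between finite ordinals. -/
def bijPROP : PROP.{0} where
  toPropSig := bijSig
  id_comp _ := rfl
  comp_id _ := rfl
  assoc _ _ _ := rfl
  tensor_id hk := by
    refine wire_ext fun i => ?_
    simp only [wire_tensor, wire_id]
    split_ifs <;> omega
  interchange hk hl hq f g f' g' := by
    refine wire_ext fun i => ?_
    simp only [wire_tensor, wire_comp]
    split_ifs with h h' h'
    · rfl
    · exact absurd (Fin.is_lt _) h'
    · omega
    · exact congrArg _ (wire_congr _ (by simp))
  tensor_assoc h₁ h₂ h₃ h₄ h₅ h₆ h₇ h₈ f g h := by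
    refine wire_ext fun i => ?_
    simp only [wire_tensor]
    split_ifs <;> first | omega | rfl | skip
    · rw [← add_assoc, h₅]
      exact congrArg _ (wire_congr _ (by simp; omega))
  unit_tensor hn hm f := by
    refine wire_ext fun i => ?_
    simp [wire_tensor]
  tensor_unit hn hm f := by
    refine wire_ext fun i => ?_
    simp [wire_tensor]
  braid_natural hk hk' hl hl' f g := by
    refine wire_ext fun i => ?_
    simp only [wire_tensor, wire_comp, wire_braid]
    split_ifs <;> first | omega | rfl | skip
    · exact congrArg _ (wire_congr _ (by simp))
  braid_symm hk hl := by
    refine wire_ext fun i => ?_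
    simp only [wire_comp, wire_braid, wire_id]
    split_ifs <;> omega
  hexagon h₁ h₂ h₃ h₄ h₅ h₆ h₇ h₈ h₉ h₁₀ h₁₁ := by
    refine wire_ext fun i => ?_
    simp only [wire_comp, wire_braid, wire_id, wire_tensor]
    split_ifs <;> omega

/-- The product of two props. -/
def PROP.prod (P : PROP.{u}) (Q : PROP.{0}) : PROP.{u} where
  Hom n m := P.Hom n m × Q.Hom n m
  id n := (P.id n, Q.id n)
  comp f g := (P.comp f.1 g.1, Q.comp f.2 g.2)
  tensor hk hl f g := (P.tensor hk hl f.1 g.1, Q.tensor hk hl f.2 g.2)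
  braid m n _ _ hk hl := (P.braid m n hk hl, Q.braid m n hk hl)
  id_comp _ := Prod.ext (P.id_comp _) (Q.id_comp _)
  comp_id _ := Prod.ext (P.comp_id _) (Q.comp_id _)
  assoc _ _ _ := Prod.ext (P.assoc _ _ _) (Q.assoc _ _ _)
  tensor_id _ := Prod.ext (P.tensor_id _) (Q.tensor_id _)
  interchange hk hl hq _ _ _ _ :=
    Prod.ext (P.interchange hk hl hq _ _ _ _) (Q.interchange hk hl hq _ _ _ _)
  tensor_assoc h₁ h₂ h₃ h₄ h₅ h₆ h₇ h₈ _ _ _ :=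
    Prod.ext (P.tensor_assoc h₁ h₂ h₃ h₄ h₅ h₆ h₇ h₈ _ _ _)
      (Q.tensor_assoc h₁ h₂ h₃ h₄ h₅ h₆ h₇ h₈ _ _ _)
  unit_tensor _ _ _ := Prod.ext (P.unit_tensor _ _ _) (Q.unit_tensor _ _ _)
  tensor_unit _ _ _ := Prod.ext (P.tensor_unit _ _ _) (Q.tensor_unit _ _ _)
  braid_natural hk hk' hl hl' _ _ :=
    Prod.ext (P.braid_natural hk hk' hl hl' _ _) (Q.braid_natural hk hk' hl hl' _ _)
  braid_symm _ _ := Prod.ext (P.braid_symm _ _) (Q.braid_symm _ _)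
  hexagon h₁ h₂ h₃ h₄ h₅ h₆ h₇ h₈ h₉ h₁₀ h₁₁ :=
    Prod.ext (P.hexagon h₁ h₂ h₃ h₄ h₅ h₆ h₇ h₈ h₉ h₁₀ h₁₁)
      (Q.hexagon h₁ h₂ h₃ h₄ h₅ h₆ h₇ h₈ h₉ h₁₀ h₁₁)

theorem SymWord.eval_prod (P : PROP.{u}) (Q : PROP.{0}) {n m : ℕ} (w : SymWord n m) :
    w.eval (P.prod Q).toPropSig = (w.eval P.toPropSig, w.eval Q.toPropSig) := by
  induction w with
  | id n => rfl
  | comp v w hv hw => simp only [SymWord.eval, hv, hw]; rfl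
  | tensor hk hl v w hv hw => simp only [SymWord.eval, hv, hw]; rfl
  | braid m n hk hl => rfl

/-! ## Consequences of the laws of props -/

namespace PROP

variable (Q : PROP.{u})

/-- The hexagon with `m = n = 0` makes `σ_{0,n}` idempotent, and an invertible idempotent is the
identity. -/
theorem braid_zero_left (n : ℕ) (hk : 0 + n = n) (hl : n + 0 = n) :
    Q.braid 0 n hk hl = Q.id n := by
  have h₁ := Q.hexagon (m := 0) (n := 0) (p := n) rfl hk hl hk hl hk hk hk hl hl hl
  rw [Q.unit_tensor, Q.tensor_unit] at h₁
  have h₂ := congrArg (fun f => Q.comp f (Q.braid n 0 hl hk)) h₁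
  simp only [Q.assoc, Q.braid_symm, Q.comp_id] at h₂
  exact h₂.symm

theorem braid_zero_right (n : ℕ) (hk : n + 0 = n) (hl : 0 + n = n) :
    Q.braid n 0 hk hl = Q.id n := by
  have h := Q.braid_symm hk hl
  rwa [Q.braid_zero_left, Q.comp_id] at h

theorem inverse_unique {n m : ℕ} {f f' : Q.Hom n m} {g : Q.Hom m n} (h : Q.comp f g = Q.id n)
    (h' : Q.comp g f' = Q.id m) : f = f' := by
  rw [← Q.comp_id f, ← h', ← Q.assoc, h, Q.id_comp]

theorem hexagon_symm {m n p mn np pn mp pm k l q : ℕ} (hmn : m + n = mn) (hnp : n + p = np)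
    (hpn : p + n = pn) (hmp : m + p = mp) (hpm : p + m = pm)
    (hk : mn + p = k) (hk' : m + np = k) (hq : m + pn = q) (hq' : mp + n = q)
    (hl : p + mn = l) (hl' : pm + n = l) :
    Q.braid p mn hl hk =
      Q.comp (Q.tensor hl' hq' (Q.braid p m hpm hmp) (Q.id n))
        (Q.tensor hq hk' (Q.id m) (Q.braid p n hpn hnp)) := by
  refine Q.inverse_unique (g := Q.braid mn p hk hl) (Q.braid_symm _ _) ?_
  rw [Q.hexagon hmn hnp hpn hmp hpm hk hk' hq hq' hl hl', Q.assoc,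
    ← Q.assoc (Q.tensor hq' hl' (Q.braid m p hmp hpm) (Q.id n)),
    ← Q.interchange, Q.braid_symm, Q.id_comp, Q.tensor_id, Q.id_comp, ← Q.interchange,
    Q.braid_symm, Q.id_comp, Q.tensor_id]

/-! ### Exchange laws for symmetries that move one wire -/

/-- The symmetry that moves the input wire `0` to the output `i`. -/
def cyc (i j : ℕ) {m : ℕ} (hm : i + 1 + j = m) : Q.Hom m m :=
  Q.tensor hm hm (Q.braid 1 i (Nat.add_comm 1 i) rfl) (Q.id j)

/-- `id₁ ⊕ f` -/
def shift {n m n' m' : ℕ} (hn : 1 + n = n') (hm : 1 + m = m') (f : Q.Hom n m) : Q.Hom n' m' :=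
  Q.tensor hn hm (Q.id 1) f

theorem shift_id {n n' : ℕ} (hn : 1 + n = n') : Q.shift hn hn (Q.id n) = Q.id n' :=
  Q.tensor_id hn

theorem shift_comp {n m k n' m' k' : ℕ} (hn : 1 + n = n') (hm : 1 + m = m') (hk : 1 + k = k')
    (f : Q.Hom n m) (g : Q.Hom m k) :
    Q.shift hn hk (Q.comp f g) = Q.comp (Q.shift hn hm f) (Q.shift hm hk g) := by
  unfold shift
  rw [← Q.interchange, Q.id_comp]

theorem cyc_zero (j : ℕ) {m : ℕ} (hm : 0 + 1 + j = m) : Q.cyc 0 j hm = Q.id m := by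
  unfold cyc
  rw [Q.braid_zero_right, Q.tensor_id]

/-- The transposition of the first two wires. -/
def swap {j m : ℕ} (hm : 2 + j = m) : Q.Hom m m :=
  Q.tensor hm hm (Q.braid 1 1 rfl rfl) (Q.id j)

theorem swap_swap {j m : ℕ} (hm : 2 + j = m) : Q.comp (Q.swap hm) (Q.swap hm) = Q.id m := by
  unfold swap
  rw [← Q.interchange, Q.braid_symm, Q.id_comp, Q.tensor_id]

/-- A double shift is `id₂ ⊕ f`, so the two arrows act on disjoint wires and the interchange law
applies. -/
theorem swap_natural {n m n' m' n'' m'' j k : ℕ} (hn : 1 + n = n') (hm : 1 + m = m')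
    (hn' : 1 + n' = n'') (hm' : 1 + m' = m'') (sn : 2 + j = n'') (sm : 2 + k = m'')
    (f : Q.Hom n m) :
    Q.comp (Q.swap sn) (Q.shift hn' hm' (Q.shift hn hm f)) =
      Q.comp (Q.shift hn' hm' (Q.shift hn hm f)) (Q.swap sm) := by
  obtain rfl : n = j := by omega
  obtain rfl : m = k := by omega
  unfold shift swap
  rw [← Q.tensor_assoc (show 1 + 1 = 2 from rfl) sn hn hn' (show 1 + 1 = 2 from rfl) sm hm hm',
    Q.tensor_id, ← Q.interchange, ← Q.interchange, Q.id_comp, Q.id_comp, Q.comp_id, Q.comp_id]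

/-- By the second hexagon, moving wire 0 past `i + 1` wires means moving it past the first of them
and then past the other `i`. -/
theorem cyc_succ (i j : ℕ) {s m m' : ℕ} (hm : i + 1 + j = m) (hm' : i + 1 + 1 + j = m')
    (h : 1 + m = m') (hs : 2 + s = m') :
    Q.cyc (i + 1) j hm' = Q.comp (Q.swap hs) (Q.shift h h (Q.cyc i j hm)) := by
  obtain rfl : s = i + j := by omega
  unfold cyc swap shift
  rw [Q.hexagon_symm (m := 1) (n := i) (p := 1) (mn := i + 1) (np := i + 1) (pn := i + 1) (mp := 2)
    (pm := 2) (k := i + 1 + 1) (l := i + 1 + 1) (q := i + 1 + 1) (by omega) (by omega) (by omega)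
    (by omega) (by omega) (by omega) (by omega) (by omega) (by omega) (by omega) (by omega),
    ← Q.id_comp (Q.id j), Q.interchange hm' hm' hm', Q.id_comp,
    Q.tensor_assoc _ hm' rfl hs _ hm' rfl hs,
    Q.tensor_assoc _ hm' hm h _ hm' hm h, Q.tensor_id]

/-- As `i' < i`, the second cycle touches only wires that `σ_{1,i}` has brought to the front, so
naturality of `σ_{1,i}` lets it act beforehand. -/
theorem cyc_cyc_of_lt {i j i' j' j'' m m' : ℕ} (hlt : i' < i) (hm : i + 1 + j = m')
    (hi' : i' + 1 + j' = m') (hi'' : i' + 1 + j'' = m) (h : 1 + m = m') :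
    Q.comp (Q.cyc i j hm) (Q.cyc i' j' hi') =
      Q.comp (Q.shift h h (Q.cyc i' j'' hi'')) (Q.cyc i j hm) := by
  obtain ⟨c, rfl⟩ : ∃ c, i = i' + 1 + c := ⟨i - (i' + 1), by omega⟩
  obtain rfl : j' = c + (1 + j) := by omega
  obtain rfl : j'' = c + j := by omega
  unfold cyc shift
  rw [← Q.tensor_id (n := c) (n' := 1 + j) rfl,
    ← Q.tensor_assoc rfl (show i' + 1 + c + (1 + j) = m' by omega) rfl hi'
      rfl (show i' + 1 + c + (1 + j) = m' by omega) rfl hi',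
    ← Q.tensor_id (n := 1) (n' := j) rfl,
    ← Q.tensor_assoc rfl hm rfl (by omega) rfl hm rfl (by omega),
    ← Q.interchange, Q.id_comp,
    ← Q.tensor_id (n := c) (n' := j) rfl,
    ← Q.tensor_assoc rfl (show i' + 1 + c + j = m by omega) rfl hi''
      rfl (show i' + 1 + c + j = m by omega) rfl hi'',
    ← Q.tensor_assoc (Nat.add_comm 1 (i' + 1 + c)) hm (by omega) h
      (Nat.add_comm 1 (i' + 1 + c)) hm (by omega) h,
    ← Q.interchange, Q.id_comp, ← Q.braid_natural]

/-- Splitting a `swap` off each of the two cycles and commuting the rest by `cyc_cyc_of_lt` brings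
the two `swap`s together, where they cancel. -/
theorem cyc_cyc_of_le {i j i' j' a b m m' : ℕ} (hle : i ≤ i') (hm : i + 1 + 1 + j = m')
    (hi' : i' + 1 + 1 + j' = m') (ha : i' + 1 + a = m) (hb : i + 1 + b = m') (h : 1 + m = m') :
    Q.comp (Q.cyc (i + 1) j hm) (Q.cyc (i' + 1) j' hi') =
      Q.comp (Q.shift h h (Q.cyc i' a ha)) (Q.cyc i b hb) := by
  obtain rfl : j' = a := by omega
  have hs : 2 + (i + j) = m' := by omega
  rw [Q.cyc_succ i j (show i + 1 + j = m by omega) hm h hs, Q.assoc,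
    ← Q.cyc_cyc_of_lt (Nat.lt_succ_of_le hle) hi' hb (show i + 1 + j = m by omega) h,
    Q.cyc_succ i' j' ha hi' h hs, Q.assoc, ← Q.assoc (Q.swap _), Q.swap_swap, Q.id_comp]

/-! ### Normal forms and coherence of the symmetries -/

/-- Arrows in normal form: `(id₁ ⊕ f) ; (σ_{1,i} ⊕ id)` with `f` in normal form. -/
inductive IsNF : {n m : ℕ} → Q.Hom n m → Prop
  | nil : IsNF (Q.id 0)
  | cons {n m n' m' i j : ℕ} {f : Q.Hom n m} (hf : IsNF f) (hn : 1 + n = n') (hm : 1 + m = m')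
      (hi : i + 1 + j = m') : IsNF (Q.comp (Q.shift hn hm f) (Q.cyc i j hi))

variable {Q}

theorem isNF_id (n : ℕ) : Q.IsNF (Q.id n) := by
  induction n with
  | zero => exact .nil
  | succ n ih =>
    have := IsNF.cons (i := 0) (j := n) ih (Nat.add_comm 1 n) (Nat.add_comm 1 n) (by omega)
    rwa [Q.cyc_zero, Q.comp_id, Q.shift_id] at this

/-- The possible values of `σ ; f`, if `f` has a normal form. -/
theorem cyc_comp_isNF {i : ℕ} : ∀ {j m k : ℕ} {f : Q.Hom m k} (_ : Q.IsNF f)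
    (hm : i + 1 + j = m), ∃ (m₀ k₀ p q : ℕ) (g : Q.Hom m₀ k₀) (h₁ : 1 + m₀ = m)
      (h₂ : 1 + k₀ = k) (h₃ : p + 1 + q = k), Q.IsNF g ∧
        Q.comp (Q.cyc i j hm) f = Q.comp (Q.shift h₁ h₂ g) (Q.cyc p q h₃) := by
  induction i with
  | zero =>
    intro j m k f hf hm
    cases hf with
    | nil => omega
    | cons hf h₁ h₂ h₃ =>
      exact ⟨_, _, _, _, _, h₁, h₂, h₃, hf, by rw [Q.cyc_zero, Q.id_comp]⟩
  | succ i ih =>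
    intro j m k f hf hm
    cases hf with
    | nil => omega
    | @cons n m n' m' c d f hf h₁ h₂ h₃ =>
      -- With `cyc (i + 1) = swap ; shift (cyc i)`, the induction hypothesis applies under `shift`.
      -- The `swap` then slides past the doubly shifted `g` and turns `shift (cyc p)` into `cyc (p +
      -- 1)`.
      have hn : i + 1 + j = n := by omega
      obtain ⟨m₀, k₀, p, q, g, h₄, h₅, h₆, hg, e⟩ := ih hf hn
      obtain ⟨c', d', a, b, x, y, z, e'⟩ : ∃ (c' d' a b : ℕ) (x : c' + 1 + d' = m)
          (y : a + 1 + b = k) (z : p + 1 + 1 + q = k),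
          Q.comp (Q.cyc (p + 1) q z) (Q.cyc c d h₃) =
            Q.comp (Q.shift h₂ h₂ (Q.cyc c' d' x)) (Q.cyc a b y) := by
        -- Which exchange law applies depends on whether the target `c` of the second cycle lies
        -- before the target `p + 1` of the first. In the second case `c` is positive and both
        -- targets drop by one.
        rcases Nat.lt_or_ge c (p + 1) with hc | hc
        · exact ⟨c, d - 1, p + 1, q, by omega, by omega, by omega, Q.cyc_cyc_of_lt hc _ _ _ _⟩
        · obtain ⟨c, rfl⟩ : ∃ c', c = c' + 1 := ⟨c - 1, by omega⟩
          exact ⟨c, d, p, q + 1, by omega, by omega, by omega,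
            Q.cyc_cyc_of_le (Nat.le_of_succ_le_succ hc) _ _ _ _ _⟩
      refine ⟨_, _, a, b, _, h₁, h₂, y, IsNF.cons hg h₄ h₅ x, ?_⟩
      have hs := (show 2 + m₀ = 1 + n by omega).trans h₁
      have hs' : 2 + k₀ = k := by omega
      rw [Q.cyc_succ i j hn hm h₁ hs, Q.assoc, ← Q.assoc (Q.shift h₁ h₁ _),
        ← Q.shift_comp, e, Q.shift_comp h₁ h₂ h₂, Q.shift_comp h₁ h₂ h₂, Q.assoc,
        ← Q.assoc, Q.swap_natural h₄ h₅ h₁ h₂ hs hs', Q.assoc,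
        ← Q.assoc (Q.swap _), ← Q.cyc_succ p q h₆ z h₂, e', Q.assoc]

/-- The last cycle of `f` is absorbed into the normal form of `g` by `cyc_comp_isNF`; what remains
to be composed sits under `shift`, where induction applies. -/
theorem IsNF.comp {n m k : ℕ} {f : Q.Hom n m} (hf : Q.IsNF f) {g : Q.Hom m k} (hg : Q.IsNF g) :
    Q.IsNF (Q.comp f g) := by
  induction hf generalizing k with
  | nil => rwa [Q.id_comp]
  | cons hf hn hm hi ih =>
    obtain ⟨m₀, k₀, p, q, g', h₁, h₂, h₃, hg', e⟩ := cyc_comp_isNF hg hi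
    obtain rfl : m₀ = _ := Nat.add_left_cancel (h₁.trans hm.symm)
    rw [Q.assoc, e, ← Q.assoc, ← Q.shift_comp]
    exact .cons (ih hg') _ _ _

theorem IsNF.tensor {n n' k m m' l : ℕ} (hk : n + n' = k) (hl : m + m' = l) {f : Q.Hom n m}
    (hf : Q.IsNF f) {g : Q.Hom n' m'} (hg : Q.IsNF g) : Q.IsNF (Q.tensor hk hl f g) := by
  induction hf generalizing k l with
  | nil =>
    obtain rfl : n' = k := by omega
    obtain rfl : m' = l := by omega
    rwa [Q.unit_tensor]
  | @cons n₀ m₀ n m i j f hf hn hm hi ih =>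
    have := IsNF.cons (n' := k) (m' := l) (i := i) (j := j + m')
      (ih (k := n₀ + n') (l := m₀ + m') rfl rfl) (by omega) (by omega) (by omega)
    -- All of `g` is performed in parallel with `shift f`, so that the outermost cycle of the first
    -- factor remains the last step.
    rw [← Q.comp_id g, Q.interchange hk hl hl]
    convert this using 2
    · exact Q.tensor_assoc _ _ _ _ _ _ _ _ _ _ _
    · unfold cyc
      rw [Q.tensor_assoc hi hl rfl (by omega) hi hl rfl (by omega), Q.tensor_id]

theorem isNF_braid (m n : ℕ) {k l : ℕ} (hk : m + n = k) (hl : n + m = l) :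
    Q.IsNF (Q.braid m n hk hl) := by
  induction m generalizing k l with
  | zero =>
    obtain rfl : n = k := by omega
    obtain rfl : n = l := by omega
    rw [Q.braid_zero_left]
    exact isNF_id _
  | succ m ih =>
    have := IsNF.cons (n' := k) (m' := l) (i := n) (j := m) (ih (k := m + n) (l := n + m) rfl rfl)
      (by omega) (by omega) (by omega)
    -- The hexagon splitting off the first of the `m + 1` wires is already a normal form: `σ_{m,n}`
    -- under `shift`, then `σ_{1,n} ⊕ id`.
    rw [Q.hexagon (m := 1) (n := m) (p := n) (np := m + n) (pn := n + m) (mp := n + 1)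
      (pm := n + 1) (q := l) (by omega) rfl rfl (by omega) rfl (by omega) (by omega) (by omega)
      (by omega) (by omega) (by omega)]
    exact this

theorem isNF_eval {n m : ℕ} (w : SymWord n m) : Q.IsNF (w.eval Q.toPropSig) := by
  induction w with
  | id n => exact isNF_id n
  | comp v w hv hw => exact hv.comp hw
  | tensor hk hl v w hv hw => exact hv.tensor hk hl hw
  | braid m n hk hl => exact isNF_braid m n hk hl

/-- Input 0 goes to `i` and the other inputs follow `f`, skipping the value `i`. Hence the bijection
determines both `i` and the bijection of `f`. -/
theorem wire_snd_comp_cyc (P : PROP.{u}) {n m n' m' i j : ℕ} {f : (P.prod bijPROP).Hom n m}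
    (hn : 1 + n = n') (hm : 1 + m = m') (hi : i + 1 + j = m') :
    ∀ a : Fin n', (wire ((P.prod bijPROP).comp ((P.prod bijPROP).shift hn hm f)
      ((P.prod bijPROP).cyc i j hi)).2 a : ℕ) = if h : (a : ℕ) = 0 then i else
        if (wire f.2 ⟨a - 1, by omega⟩ : ℕ) < i then (wire f.2 ⟨a - 1, by omega⟩ : ℕ)
        else (wire f.2 ⟨a - 1, by omega⟩ : ℕ) + 1 := by
  intro a
  change (wire (bijSig.comp (bijSig.tensor hn hm (bijSig.id 1) f.2)
    (bijSig.tensor hi hi (bijSig.braid 1 i (Nat.add_comm 1 i) rfl) (bijSig.id j))) a : ℕ) = _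
  have hb := wire_tensor hn hm (bijSig.id 1) f.2 a
  rw [wire_comp]
  generalize wire (bijSig.tensor hn hm (bijSig.id 1) f.2) a = b at hb ⊢
  simp only [wire_id] at hb
  simp only [wire_tensor, wire_braid, wire_id]
  split_ifs at hb ⊢ <;> omega

/-- In the product of a prop with the prop of bijections, arrows in normal form are determined by
their underlying bijections. -/
theorem IsNF.ext {P : PROP.{u}} {n m : ℕ} {f : (P.prod bijPROP).Hom n m}
    (hf : (P.prod bijPROP).IsNF f) {g : (P.prod bijPROP).Hom n m}
    (hg : (P.prod bijPROP).IsNF g) (h : f.2 = g.2) : f = g := by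
  induction hf with
  | nil =>
    cases hg with
    | nil => rfl
    | cons => omega
  | cons hf hn hm hi ih =>
    cases hg with
    | nil => omega
    | cons hg hn' hm' hi' =>
      obtain rfl := Nat.add_left_cancel (hn.trans hn'.symm)
      obtain rfl := Nat.add_left_cancel (hm.trans hm'.symm)
      have key := fun a => (wire_snd_comp_cyc P hn hm hi a).symm.trans
        ((congrArg (fun e => (wire e a : ℕ)) h).trans (wire_snd_comp_cyc P hn' hm' hi' a))
      -- The image of 0 recovers `i`; the images of the successors then recover the bijection of the
      -- tail, because skipping `i` is injective.
      have h₀ := key ⟨0, by omega⟩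
      simp only [dif_pos] at h₀
      subst h₀
      obtain rfl := Nat.add_left_cancel (hi.trans hi'.symm)
      rw [ih hg (wire_ext fun a => ?_)]
      have := key ⟨a + 1, by omega⟩
      simp only [Nat.add_sub_cancel, Nat.succ_ne_zero, dif_neg, not_false_eq_true, Fin.eta] at this
      split_ifs at this <;> omega

end PROP

/-- Coherence: the value of a word in the symmetries is determined by its underlying bijection. -/
theorem SymWord.eval_congr (P : PROP.{u}) {n m : ℕ} {v w : SymWord n m}
    (h : v.toEquiv = w.toEquiv) : v.eval P.toPropSig = w.eval P.toPropSig := by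
  -- In the product with `bijPROP`, the value of a word carries its underlying bijection along, so
  -- equality of bijections becomes available to `IsNF.ext`.
  have := (PROP.isNF_eval (Q := P.prod bijPROP) v).ext (PROP.isNF_eval w) (by
    rw [v.eval_prod, w.eval_prod]; exact h)
  rw [v.eval_prod, w.eval_prod] at this
  exact congrArg Prod.fst this

/-! ### Every bijection comes from a word -/

namespace SymWord

theorem exists_toEquiv_swap {n : ℕ} (i : Fin n) :
    ∃ w : SymWord (n + 1) (n + 1), w.toEquiv = Equiv.swap i.castSucc i.succ := by
  have h : (i : ℕ) + 2 + (n - 1 - i) = n + 1 := by omega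
  -- The word is `id_i ⊕ σ_{1,1} ⊕ id`, with `n - 1 - i` wires left over on the right.
  refine ⟨.tensor h h (.tensor rfl rfl (.id i) (.braid 1 1 rfl rfl)) (.id _), ?_⟩
  refine wire_ext fun j => ?_
  have : (wire (Equiv.swap i.castSucc i.succ) j : ℕ) =
      if (j : ℕ) = i then (i : ℕ) + 1 else if (j : ℕ) = i + 1 then (i : ℕ) else j := by
    simp only [wire, Equiv.toFun_as_coe, Equiv.swap_apply_def, Fin.ext_iff, Fin.val_castSucc,
      Fin.val_succ]
    split_ifs <;> rfl
  rw [this]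
  simp only [toEquiv, eval, wire_tensor, wire_braid, wire_id]
  split_ifs <;> omega

theorem exists_toEquiv_perm (n : ℕ) (e : Equiv.Perm (Fin n)) :
    ∃ w : SymWord n n, w.toEquiv = e := by
  cases n with
  | zero => exact ⟨.id 0, Subsingleton.elim _ _⟩
  | succ n =>
    have he : e ∈ Submonoid.closure
        (Set.range fun i : Fin n => Equiv.swap i.castSucc i.succ) := by
      -- Adjacent transpositions generate all permutations already as a monoid, so no words for
      -- inverses are needed.
      rw [Equiv.Perm.mclosure_swap_castSucc_succ]
      trivial
    induction he using Submonoid.closure_induction with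
    | mem x hx => obtain ⟨i, rfl⟩ := hx; exact exists_toEquiv_swap i
    | one => exact ⟨.id _, rfl⟩
    | mul x y _ _ hx hy =>
      obtain ⟨v, rfl⟩ := hx
      obtain ⟨w, rfl⟩ := hy
      -- A product of permutations applies its right factor first, hence the reversed order in
      -- diagrammatic notation.
      exact ⟨.comp w v, rfl⟩

theorem toEquiv_surjective {n m : ℕ} (e : Fin n ≃ Fin m) : ∃ w : SymWord n m, w.toEquiv = e := by
  obtain rfl : n = m := by simpa using Fintype.card_congr e
  exact exists_toEquiv_perm n e

end SymWord

/-- The juxtaposition of two bijections. -/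
def finSum {n n' k m m' l : ℕ} (hk : n + n' = k) (hl : m + m' = l) (e : Fin n ≃ Fin m)
    (e' : Fin n' ≃ Fin m') : Fin k ≃ Fin l := bijSig.tensor hk hl e e'

/-- The bijection that interchanges the first `m` and the last `n` elements. -/
def finBraid (m n : ℕ) {k l : ℕ} (hk : m + n = k) (hl : n + m = l) : Fin k ≃ Fin l :=
  bijSig.braid m n hk hl

theorem finSum_val {n n' k m m' l : ℕ} (hk : n + n' = k) (hl : m + m' = l)
    (e : Fin n ≃ Fin m) (e' : Fin n' ≃ Fin m') (i : Fin k) :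
    (finSum hk hl e e' i : ℕ) =
      if h : (i : ℕ) < n then (e ⟨i, h⟩ : ℕ) else m + (e' ⟨i - n, by omega⟩ : ℕ) :=
  wire_tensor hk hl e e' i

theorem finBraid_val (m n : ℕ) {k l : ℕ} (hk : m + n = k) (hl : n + m = l) (i : Fin k) :
    (finBraid m n hk hl i : ℕ) = if (i : ℕ) < m then n + i else i - m :=
  wire_braid m n hk hl i

/-! ### Bijections as arrows of a prop -/

namespace PROP

variable (P : PROP.{u})

/-- The arrow of a prop given by a bijection. -/
def perm {n m : ℕ} (e : Fin n ≃ Fin m) : P.Hom n m :=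
  (SymWord.toEquiv_surjective e).choose.eval P.toPropSig

/-- By coherence the word chosen in `perm` does not matter. The compatibility of `perm` with all
operations follows, since words are closed under them. -/
theorem eval_eq_perm {n m : ℕ} (w : SymWord n m) {e : Fin n ≃ Fin m} (h : w.toEquiv = e) :
    w.eval P.toPropSig = P.perm e :=
  SymWord.eval_congr P (h.trans (SymWord.toEquiv_surjective e).choose_spec.symm)

theorem perm_refl (n : ℕ) : P.perm (Equiv.refl (Fin n)) = P.id n :=
  (P.eval_eq_perm (.id n) rfl).symm

theorem perm_trans {n m k : ℕ} (e : Fin n ≃ Fin m) (e' : Fin m ≃ Fin k) :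
    P.perm (e.trans e') = P.comp (P.perm e) (P.perm e') := by
  obtain ⟨v, rfl⟩ := SymWord.toEquiv_surjective e
  obtain ⟨w, rfl⟩ := SymWord.toEquiv_surjective e'
  rw [← P.eval_eq_perm v rfl, ← P.eval_eq_perm w rfl]
  exact (P.eval_eq_perm (.comp v w) rfl).symm

theorem perm_tensor {n n' k m m' l : ℕ} (hk : n + n' = k) (hl : m + m' = l)
    (e : Fin n ≃ Fin m) (e' : Fin n' ≃ Fin m') :
    P.perm (finSum hk hl e e') = P.tensor hk hl (P.perm e) (P.perm e') := by
  obtain ⟨v, rfl⟩ := SymWord.toEquiv_surjective e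
  obtain ⟨w, rfl⟩ := SymWord.toEquiv_surjective e'
  rw [← P.eval_eq_perm v rfl, ← P.eval_eq_perm w rfl]
  exact (P.eval_eq_perm (.tensor hk hl v w) rfl).symm

theorem perm_braid (m n : ℕ) {k l : ℕ} (hk : m + n = k) (hl : n + m = l) :
    P.perm (finBraid m n hk hl) = P.braid m n hk hl :=
  (P.eval_eq_perm (.braid m n hk hl) rfl).symm

end PROP

set_option linter.unusedSectionVars false

section

variable {𝒩 : Type} [DecidableEq 𝒩]

/-! ## Lists of names -/

namespace IsDisjUnion

theorem symm {A B C : Finset 𝒩} (h : IsDisjUnion A B C) : IsDisjUnion B A C :=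
  ⟨h.1.symm, by rw [Finset.union_comm, h.2]⟩

theorem assoc {A₁ A₂ A₃ A₂₃ A : Finset 𝒩} (h : IsDisjUnion A₁ A₂₃ A)
    (h' : IsDisjUnion A₂ A₃ A₂₃) : IsDisjUnion A₁ A₂ (A₁ ∪ A₂) ∧ IsDisjUnion (A₁ ∪ A₂) A₃ A := by
  obtain ⟨h₁, rfl⟩ := h
  obtain ⟨h₂, rfl⟩ := h'
  rw [Finset.disjoint_union_right] at h₁
  exact ⟨⟨h₁.1, rfl⟩, ⟨Finset.disjoint_union_left.2 ⟨h₁.2, h₂⟩, Finset.union_assoc _ _ _⟩⟩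

theorem append_val {A A' C : Finset 𝒩} (h : IsDisjUnion A A' C) {n n' k : ℕ} (hk : n + n' = k)
    (a : Fin n ≃ A) (a' : Fin n' ≃ A') (i : Fin k) :
    (h.append hk a a' i : 𝒩) =
      if h : (i : ℕ) < n then (a ⟨i, h⟩ : 𝒩) else a' ⟨i - n, by omega⟩ := by
  subst hk
  refine Fin.addCases (fun j => ?_) (fun j => ?_) i
  · have hj : ((Fin.castAdd n' j : Fin (n + n')) : ℕ) < n := j.2
    rw [dif_pos hj]
    simp [append, sumEquiv]
  · simp [append, sumEquiv]

theorem finSum_trans_append {B B' D : Finset 𝒩} (hD : IsDisjUnion B B' D) {n n' k m m' l : ℕ}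
    (hk : n + n' = k) (hl : m + m' = l) (e : Fin n ≃ Fin m) (e' : Fin n' ≃ Fin m')
    (b : Fin m ≃ B) (b' : Fin m' ≃ B') :
    (finSum hk hl e e').trans (hD.append hl b b') = hD.append hk (e.trans b) (e'.trans b') := by
  refine Equiv.ext fun i => Subtype.ext ?_
  have := finSum_val hk hl e e' i
  rw [Equiv.trans_apply, append_val, append_val]
  split_ifs at this ⊢ <;> first | omega | skip
  · rw [Equiv.trans_apply]
    congr 2
    exact Fin.ext this
  · rw [Equiv.trans_apply]
    congr 2
    exact Fin.ext (by simp [this])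

/-- A change between two concatenated lists over the same pair of sets is a juxtaposition of two
changes, so `perm_tensor` turns it into a parallel composite. -/
theorem append_trans_symm {B B' D : Finset 𝒩} (hD : IsDisjUnion B B' D) {n n' k m m' l : ℕ}
    (hk : n + n' = k) (hl : m + m' = l) (a : Fin n ≃ B) (a' : Fin n' ≃ B')
    (b : Fin m ≃ B) (b' : Fin m' ≃ B') :
    (hD.append hk a a').trans (hD.append hl b b').symm =
      finSum hk hl (a.trans b.symm) (a'.trans b'.symm) := by
  have h : hD.append hk a a' =
      (finSum hk hl (a.trans b.symm) (a'.trans b'.symm)).trans (hD.append hl b b') := by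
    rw [finSum_trans_append]
    congr 1 <;> ext <;> simp
  rw [h]
  ext
  simp

theorem append_trans_bij {A A' C B B' D : Finset 𝒩} (hC : IsDisjUnion A A' C)
    (hD : IsDisjUnion B B' D) (e : A ≃ B) (e' : A' ≃ B') {n n' k : ℕ} (hk : n + n' = k)
    (a : Fin n ≃ A) (a' : Fin n' ≃ A') :
    (hC.append hk a a').trans (hC.bij hD e e') = hD.append hk (a.trans e) (a'.trans e') := by
  refine Equiv.ext fun i => ?_
  simp [append, bij]

theorem append_assoc {A₁ A₂ A₃ A₁₂ A₂₃ A : Finset 𝒩}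
    (hA₁₂ : IsDisjUnion A₁ A₂ A₁₂) (hA : IsDisjUnion A₁₂ A₃ A)
    (hA₂₃ : IsDisjUnion A₂ A₃ A₂₃) (hA' : IsDisjUnion A₁ A₂₃ A) {n₁ n₂ n₃ n₁₂ n₂₃ n : ℕ}
    (hn₁₂ : n₁ + n₂ = n₁₂) (hn : n₁₂ + n₃ = n) (hn₂₃ : n₂ + n₃ = n₂₃) (hn' : n₁ + n₂₃ = n)
    (a₁ : Fin n₁ ≃ A₁) (a₂ : Fin n₂ ≃ A₂) (a₃ : Fin n₃ ≃ A₃) :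
    hA.append hn (hA₁₂.append hn₁₂ a₁ a₂) a₃ = hA'.append hn' a₁ (hA₂₃.append hn₂₃ a₂ a₃) := by
  refine Equiv.ext fun i => Subtype.ext ?_
  simp only [append_val]
  split_ifs <;> first | omega | rfl | skip
  congr 3
  omega

/-- This links commutativity of `⊎` with naturality of the symmetries: reversing the order of two
lists costs exactly one block symmetry. -/
theorem append_comm {A A' C : Finset 𝒩} (hC : IsDisjUnion A A' C) (hC' : IsDisjUnion A' A C)
    {n n' k l : ℕ} (hk : n + n' = k) (hl : n' + n = l) (a : Fin n ≃ A) (a' : Fin n' ≃ A') :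
    hC.append hk a a' = (finBraid n n' hk hl).trans (hC'.append hl a' a) := by
  refine Equiv.ext fun i => Subtype.ext ?_
  have := finBraid_val n n' hk hl i
  rw [Equiv.trans_apply, append_val, append_val]
  split_ifs at this ⊢ <;> first | omega | skip
  · congr 2
    exact Fin.ext (by simp [this])
  · congr 2
    exact Fin.ext this.symm

theorem empty_append {A : Finset 𝒩} (h : IsDisjUnion ∅ A A) {n : ℕ} (hn : 0 + n = n)
    (a₀ : Fin 0 ≃ (∅ : Finset 𝒩)) (a : Fin n ≃ A) : h.append hn a₀ a = a := by
  refine Equiv.ext fun i => Subtype.ext ?_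
  simp [append_val]

theorem append_empty {A : Finset 𝒩} (h : IsDisjUnion A ∅ A) {n : ℕ} (hn : n + 0 = n)
    (a : Fin n ≃ A) (a₀ : Fin 0 ≃ (∅ : Finset 𝒩)) : h.append hn a a₀ = a := by
  refine Equiv.ext fun i => Subtype.ext ?_
  simp [append_val]

/-- Every list of length `n + n'` is a concatenation. -/
theorem exists_append {C : Finset 𝒩} {n n' k : ℕ} (hk : n + n' = k) (c : Fin k ≃ C) :
    ∃ (A A' : Finset 𝒩) (h : IsDisjUnion A A' C) (a : Fin n ≃ A) (a' : Fin n' ≃ A'),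
      h.append hk a a' = c := by
  subst hk
  have hinj : Function.Injective fun i => (c i : 𝒩) := Subtype.val_injective.comp c.injective
  let i₁ : Fin n ↪ 𝒩 := ⟨fun i => c (Fin.castAdd n' i), hinj.comp (Fin.castAdd_injective n n')⟩
  let i₂ : Fin n' ↪ 𝒩 := ⟨fun i => c (Fin.natAdd n i), hinj.comp (Fin.natAdd_injective n' n)⟩
  have hd : IsDisjUnion (Finset.univ.map i₁) (Finset.univ.map i₂) C := by
    constructor
    · rw [Finset.disjoint_left]
      intro x hx hy
      obtain ⟨i, -, rfl⟩ := Finset.mem_map.1 hx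
      obtain ⟨j, -, hj⟩ := Finset.mem_map.1 hy
      have := congrArg Fin.val (hinj hj)
      simp at this
      omega
    · ext x
      simp only [Finset.mem_union, Finset.mem_map, Finset.mem_univ, true_and]
      constructor
      · rintro (⟨i, rfl⟩ | ⟨i, rfl⟩) <;> exact Subtype.coe_prop _
      · intro hx
        obtain ⟨i, hi⟩ := c.surjective ⟨x, hx⟩
        obtain rfl : (c i : 𝒩) = x := congrArg Subtype.val hi
        refine Fin.addCases (fun j => ?_) (fun j => ?_) i
        · exact .inl ⟨j, rfl⟩
        · exact .inr ⟨j, rfl⟩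
  -- An injective family of names is a list of its image; both halves of `c` are treated this way.
  have e (r : ℕ) (i : Fin r ↪ 𝒩) : ∃ a : Fin r ≃ (Finset.univ.map i : Finset 𝒩),
      ∀ j, (a j : 𝒩) = i j :=
    ⟨Equiv.ofBijective (fun j => ⟨i j, by simp⟩)
      ⟨fun x y h => i.injective (congrArg Subtype.val h), fun ⟨x, hx⟩ => by
        obtain ⟨j, -, rfl⟩ := Finset.mem_map.1 hx
        exact ⟨j, rfl⟩⟩, fun _ => rfl⟩
  obtain ⟨a, ha⟩ := e n i₁
  obtain ⟨a', ha'⟩ := e n' i₂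
  refine ⟨_, _, hd, a, a', Equiv.ext fun i => Subtype.ext ?_⟩
  rw [append_val]
  refine Fin.addCases (fun j => ?_) (fun j => ?_) i
  · rw [dif_pos (show ((Fin.castAdd n' j : Fin _) : ℕ) < n from j.2), ha]
    rfl
  · rw [dif_neg (by simp), ha']
    simp [i₂]

end IsDisjUnion

namespace PROP

variable {S : PROP.{u}}

theorem perm_comp_perm {n m k : ℕ} (e : Fin n ≃ Fin m) (e' : Fin m ≃ Fin k) :
    S.comp (S.perm e) (S.perm e') = S.perm (e.trans e') := (S.perm_trans e e').symm

theorem perm_comp_perm_comp {n m k l : ℕ} (e : Fin n ≃ Fin m) (e' : Fin m ≃ Fin k)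
    (f : S.Hom k l) :
    S.comp (S.perm e) (S.comp (S.perm e') f) = S.comp (S.perm (e.trans e')) f := by
  rw [← S.assoc, S.perm_trans]

theorem perm_eq_id {n : ℕ} {e : Fin n ≃ Fin n} (h : ∀ i, e i = i) :
    S.perm e = S.id n := by
  rw [← S.perm_refl]
  congr 1
  exact Equiv.ext h

end PROP

/-! ## A model of `NOM(S)` -/

namespace NOM.Model

variable (S : PROP.{u})

/-- An enumeration of a finite set. -/
def enum (A : Finset 𝒩) : Fin A.card ≃ A := A.equivFin.symm

variable {S}

/-- The arrow obtained from an arrow between cardinalities by listing the inputs according to `a`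
and the outputs according to `b`. -/
def coord {n m : ℕ} {A B : Finset 𝒩} (a : Fin n ≃ A) (b : Fin m ≃ B) (f : S.Hom A.card B.card) :
    S.Hom n m :=
  S.comp (S.perm (a.trans (enum A).symm)) (S.comp f (S.perm ((enum B).trans b.symm)))

/-- The inverse of `coord a b`. -/
def ofCoord {n m : ℕ} {A B : Finset 𝒩} (a : Fin n ≃ A) (b : Fin m ≃ B) (f : S.Hom n m) :
    S.Hom A.card B.card :=
  S.comp (S.perm ((enum A).trans a.symm)) (S.comp f (S.perm (b.trans (enum B).symm)))

theorem coord_ofCoord {n m : ℕ} {A B : Finset 𝒩} (a : Fin n ≃ A) (b : Fin m ≃ B) (f : S.Hom n m) :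
    coord a b (ofCoord a b f) = f := by
  simp only [coord, ofCoord, S.assoc, PROP.perm_comp_perm_comp, PROP.perm_comp_perm]
  rw [PROP.perm_eq_id (by simp), PROP.perm_eq_id (by simp), S.id_comp, S.comp_id]

theorem ofCoord_coord {n m : ℕ} {A B : Finset 𝒩} (a : Fin n ≃ A) (b : Fin m ≃ B)
    (f : S.Hom A.card B.card) : ofCoord a b (coord a b f) = f := by
  simp only [coord, ofCoord, S.assoc, PROP.perm_comp_perm_comp, PROP.perm_comp_perm]
  rw [PROP.perm_eq_id (by simp), PROP.perm_eq_id (by simp), S.id_comp, S.comp_id]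

theorem coord_injective {n m : ℕ} {A B : Finset 𝒩} (a : Fin n ≃ A) (b : Fin m ≃ B) :
    Function.Injective (coord (S := S) a b) :=
  Function.LeftInverse.injective (ofCoord_coord a b)

theorem coord_change {n m n' m' : ℕ} {A B : Finset 𝒩} (a : Fin n ≃ A) (b : Fin m ≃ B)
    (a' : Fin n' ≃ A) (b' : Fin m' ≃ B) (f : S.Hom A.card B.card) :
    coord a' b' f =
      S.comp (S.perm (a'.trans a.symm)) (S.comp (coord a b f) (S.perm (b.trans b'.symm))) := by
  have h : (a'.trans a.symm).trans (a.trans (enum A).symm) = a'.trans (enum A).symm := by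
    ext; simp
  have h' : ((enum B).trans b.symm).trans (b.trans b'.symm) = (enum B).trans b'.symm := by
    ext; simp
  simp only [coord, S.assoc, PROP.perm_comp_perm_comp, PROP.perm_comp_perm, h, h']

theorem coord_id {n m : ℕ} {A : Finset 𝒩} (a : Fin n ≃ A) (b : Fin m ≃ A) :
    coord a b (S.id A.card) = S.perm (a.trans b.symm) := by
  simp only [coord, S.id_comp, PROP.perm_comp_perm]
  congr 1; ext; simp

theorem coord_comp {n m k : ℕ} {A B C : Finset 𝒩} (a : Fin n ≃ A) (b : Fin m ≃ B) (c : Fin k ≃ C)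
    (f : S.Hom A.card B.card) (g : S.Hom B.card C.card) :
    coord a c (S.comp f g) = S.comp (coord a b f) (coord b c g) := by
  simp only [coord, S.assoc, PROP.perm_comp_perm_comp]
  rw [PROP.perm_eq_id (e := ((enum B).trans b.symm).trans (b.trans (enum B).symm)) (by simp),
    S.id_comp]

variable (S)

/-- The arrow of the model given by a bijection. -/
def ren {A B : Finset 𝒩} (e : A ≃ B) : S.Hom A.card B.card :=
  S.perm ((enum A).trans (e.trans (enum B).symm))

variable {S}

theorem coord_ren {n m : ℕ} {A B : Finset 𝒩} (a : Fin n ≃ A) (b : Fin m ≃ B) (e : A ≃ B) :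
    coord a b (ren S e) = S.perm (a.trans (e.trans b.symm)) := by
  simp only [coord, ren, PROP.perm_comp_perm]
  congr 1; ext; simp

/-- The tensor of the model. -/
def tensor {A A' C B B' D : Finset 𝒩} (hC : IsDisjUnion A A' C) (hD : IsDisjUnion B B' D)
    (f : S.Hom A.card B.card) (g : S.Hom A'.card B'.card) : S.Hom C.card D.card :=
  ofCoord (hC.append rfl (enum A) (enum A')) (hD.append rfl (enum B) (enum B'))
    (S.tensor rfl rfl f g)

/-- `tensor` was defined through particular enumerations. Any other pair of concatenated lists
differs from these by juxtaposed permutations, which the interchange law absorbs into the two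
factors. -/
theorem coord_tensor {n n' k m m' l : ℕ} (hk : n + n' = k) (hl : m + m' = l)
    {A A' C B B' D : Finset 𝒩} (hC : IsDisjUnion A A' C) (hD : IsDisjUnion B B' D)
    (a : Fin n ≃ A) (a' : Fin n' ≃ A') (b : Fin m ≃ B) (b' : Fin m' ≃ B')
    (f : S.Hom A.card B.card) (g : S.Hom A'.card B'.card) :
    coord (hC.append hk a a') (hD.append hl b b') (tensor hC hD f g) =
      S.tensor hk hl (coord a b f) (coord a' b' g) := by
  rw [coord_change (hC.append rfl (enum A) (enum A')) (hD.append rfl (enum B) (enum B')),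
    tensor, coord_ofCoord, IsDisjUnion.append_trans_symm, IsDisjUnion.append_trans_symm,
    S.perm_tensor, S.perm_tensor, ← S.interchange, ← S.interchange]
  rfl

variable (S)

/-- The nominal prop whose arrows `A → B` are the arrows of `S` between the cardinalities of `A`
and `B`, with names attached by `enum`. -/
def obj : NPROP.{u} 𝒩 where
  Hom A B := S.Hom A.card B.card
  id A := S.id A.card
  comp := S.comp
  ren := ren S
  tensor := tensor
  id_comp := S.id_comp
  comp_id := S.comp_id
  assoc := S.assoc
  ren_refl A := PROP.perm_eq_id (by simp)
  ren_trans e e' := by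
    simp only [ren, PROP.perm_comp_perm]
    congr 1; ext; simp
  ren_tensor {A A' C B B' D} hC hD e e' := by
    -- An equation may be tested in any coordinates. In concatenated lists `⊎` becomes `⊕`, and the
    -- law reduces to one of `S`; the remaining tensor laws are treated alike.
    apply coord_injective (hC.append rfl (enum A) (enum A')) (hD.append rfl (enum B) (enum B'))
    rw [coord_tensor, coord_ren, coord_ren, coord_ren, ← S.perm_tensor,
      ← Equiv.trans_assoc (hC.append _ _ _), IsDisjUnion.append_trans_bij,
      IsDisjUnion.append_trans_symm]
    rfl
  tensor_id {A A' C} hC := by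
    apply coord_injective (hC.append rfl (enum A) (enum A')) (hC.append rfl (enum A) (enum A'))
    rw [coord_tensor, coord_id, coord_id, coord_id, ← S.perm_tensor,
      ← IsDisjUnion.append_trans_symm]
  interchange {A A' P B B' Q C C' R} hP hQ hR f g f' g' := by
    apply coord_injective (hP.append rfl (enum A) (enum A')) (hR.append rfl (enum C) (enum C'))
    rw [coord_tensor, coord_comp _ (enum B), coord_comp _ (enum B'), S.interchange rfl rfl rfl,
      ← coord_tensor rfl rfl hP hQ, ← coord_tensor rfl rfl hQ hR, ← coord_comp]
  tensor_assoc {A₁ A₂ A₃ A₁₂ A₂₃ A B₁ B₂ B₃ B₁₂ B₂₃ B} h₁ h₂ h₃ h₄ h₅ h₆ h₇ h₈ f g h := by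
    apply coord_injective (h₂.append rfl (h₁.append rfl (enum A₁) (enum A₂)) (enum A₃))
      (h₆.append rfl (h₅.append rfl (enum B₁) (enum B₂)) (enum B₃))
    rw [coord_tensor, coord_tensor, IsDisjUnion.append_assoc h₁ h₂ h₃ h₄ rfl rfl rfl (by omega),
      IsDisjUnion.append_assoc h₅ h₆ h₇ h₈ rfl rfl rfl (by omega), coord_tensor, coord_tensor,
      S.tensor_assoc]
  unit_tensor {A B} hA hB f := by
    have a₀ : Fin 0 ≃ (∅ : Finset 𝒩) := enum ∅
    apply coord_injective (hA.append (Nat.zero_add _) a₀ (enum A))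
      (hB.append (Nat.zero_add _) a₀ (enum B))
    rw [coord_tensor, coord_id, PROP.perm_eq_id (by simp), S.unit_tensor,
      IsDisjUnion.empty_append, IsDisjUnion.empty_append]
  tensor_unit {A B} hA hB f := by
    have a₀ : Fin 0 ≃ (∅ : Finset 𝒩) := enum ∅
    apply coord_injective (hA.append (Nat.add_zero _) (enum A) a₀)
      (hB.append (Nat.add_zero _) (enum B) a₀)
    rw [coord_tensor, coord_id, PROP.perm_eq_id (by simp), S.tensor_unit,
      IsDisjUnion.append_empty, IsDisjUnion.append_empty]
  tensor_comm {A A' C B B' D} hC hC' hD hD' f g := by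
    apply coord_injective (hC.append rfl (enum A) (enum A')) (hD.append rfl (enum B) (enum B'))
    -- Reading the right-hand side in the order `A'`, `A` gives `g ⊕ f` between two block
    -- symmetries, which equals `f ⊕ g` by naturality.
    rw [coord_tensor, coord_change (hC'.append (Nat.add_comm _ _) (enum A') (enum A))
      (hD'.append (Nat.add_comm _ _) (enum B') (enum B)), coord_tensor,
      hC.append_comm hC' rfl (Nat.add_comm _ _), hD'.append_comm hD (Nat.add_comm _ _) rfl]
    simp only [Equiv.trans_assoc, Equiv.self_trans_symm, Equiv.trans_refl]
    rw [S.perm_braid, S.perm_braid, S.braid_natural, ← S.assoc, S.braid_symm, S.id_comp]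

end NOM.Model

/-! ### Arrows of `NOM(S)` in given lists are arrows of `S` -/

namespace NOM

variable {S : PROP.{u}}

/-- The interpretation of terms in the model, with `[a⟩ f ⟨b]` having the coordinates `f`. -/
def Model.eval : {A B : Finset 𝒩} → Term 𝒩 S A B → (Model.obj (𝒩 := 𝒩) S).Hom A B
  | _, _, .gen a b f => Model.ofCoord a b f
  | _, _, .id A => (Model.obj S).id A
  | _, _, .ren e => (Model.obj S).ren e
  | _, _, .comp t s => (Model.obj S).comp (eval t) (eval s)
  | _, _, .tensor hC hD t s => (Model.obj S).tensor hC hD (eval t) (eval s)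

-- The laws of nominal props hold since the model is one; the five defining equations become evident
-- in the coordinates given by their own lists. Coherence lets the two equations on symmetries hold
-- for every word `w`.
open Model in
theorem Model.eval_rel {A B : Finset 𝒩} {t s : Term 𝒩 S A B} (h : Rel S t s) :
    eval t = eval s := by
  induction h with
  | refl t => rfl
  | symm _ ih => exact ih.symm
  | trans _ _ ih ih' => exact ih.trans ih'
  | comp_congr _ _ ih ih' => exact congrArg₂ _ ih ih'
  | tensor_congr hC hD _ _ ih ih' => exact congrArg₂ _ ih ih'
  | id_comp t => exact (Model.obj S).id_comp _
  | comp_id t => exact (Model.obj S).comp_id _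
  | assoc t s r => exact (Model.obj S).assoc _ _ _
  | ren_refl A => exact (Model.obj S).ren_refl A
  | ren_trans e e' => exact (Model.obj S).ren_trans e e'
  | ren_tensor hC hD e e' => exact (Model.obj S).ren_tensor hC hD e e'
  | tensor_id hC => exact (Model.obj S).tensor_id hC
  | interchange hP hQ hR t s t' s' => exact (Model.obj S).interchange hP hQ hR _ _ _ _
  | tensor_assoc h₁ h₂ h₃ h₄ h₅ h₆ h₇ h₈ t s r =>
    exact (Model.obj S).tensor_assoc h₁ h₂ h₃ h₄ h₅ h₆ h₇ h₈ _ _ _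
  | unit_tensor hA hB t => exact (Model.obj S).unit_tensor hA hB _
  | tensor_unit hA hB t => exact (Model.obj S).tensor_unit hA hB _
  | tensor_comm hC hC' hD hD' t s => exact (Model.obj S).tensor_comm hC hC' hD hD' _ _
  | gen_comp a b c f g =>
    apply coord_injective a c
    change coord a c (ofCoord a c _) = coord a c (S.comp (ofCoord a b f) (ofCoord b c g))
    rw [coord_comp a b c, coord_ofCoord, coord_ofCoord, coord_ofCoord]
  | gen_tensor hk hl hC hD a c b d f g =>
    apply coord_injective (hC.append hk a c) (hD.append hl b d)
    change coord _ _ (ofCoord _ _ _) = coord _ _ (tensor hC hD (ofCoord a b f) (ofCoord c d g))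
    rw [coord_tensor, coord_ofCoord, coord_ofCoord, coord_ofCoord]
  | gen_id a b =>
    apply coord_injective a b
    change coord a b (ofCoord a b _) = coord a b (ren S _)
    rw [coord_ofCoord, coord_ren]
    exact (PROP.perm_eq_id (by simp)).symm
  | gen_symm_comp a b b' c f w hw =>
    apply coord_injective a c
    change coord a c (ofCoord a c _) = coord a c (S.comp (ren S _) (ofCoord b' c f))
    rw [coord_comp a b' c, coord_ofCoord, coord_ofCoord, coord_ren, S.eval_eq_perm w hw]
    congr 2; ext; simp
  | gen_comp_symm a b b' c f w hw =>
    apply coord_injective a c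
    change coord a c (ofCoord a c _) = coord a c (S.comp (ofCoord a b f) (ren S _))
    rw [coord_comp a b c, coord_ofCoord, coord_ofCoord, coord_ren, S.eval_eq_perm w hw]
    congr 2; ext; simp

/-- The interpretation descends to the quotient, and the coordinates of the value of `[a⟩ f ⟨b]` in
`a`, `b` give back `f`. -/
theorem arr_injective {n m : ℕ} {A B : Finset 𝒩} (a : Fin n ≃ A) (b : Fin m ≃ B) :
    Function.Injective fun f : S.Hom n m => arr a b f := fun f g h => by
  have := congrArg (Quot.lift Model.eval fun _ _ => Model.eval_rel) h
  have h' : Model.ofCoord a b f = Model.ofCoord a b g := this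
  rw [← Model.coord_ofCoord a b f, h', Model.coord_ofCoord]

theorem arr_comp {n m k : ℕ} {A B C : Finset 𝒩} (a : Fin n ≃ A) (b : Fin m ≃ B) (c : Fin k ≃ C)
    (f : S.Hom n m) (g : S.Hom m k) :
    arr a c (S.comp f g) = (obj 𝒩 S).comp (arr a b f) (arr b c g) :=
  Quot.sound (.gen_comp a b c f g)

theorem arr_tensor {n n' k m m' l : ℕ} (hk : n + n' = k) (hl : m + m' = l)
    {A A' C B B' D : Finset 𝒩} (hC : IsDisjUnion A A' C) (hD : IsDisjUnion B B' D)
    (a : Fin n ≃ A) (c : Fin n' ≃ A') (b : Fin m ≃ B) (d : Fin m' ≃ B')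
    (f : S.Hom n m) (g : S.Hom n' m') :
    arr (hC.append hk a c) (hD.append hl b d) (S.tensor hk hl f g) =
      (obj 𝒩 S).tensor hC hD (arr a b f) (arr c d g) :=
  Quot.sound (.gen_tensor hk hl hC hD a c b d f g)

theorem arr_id {n : ℕ} {A B : Finset 𝒩} (a : Fin n ≃ A) (b : Fin n ≃ B) :
    arr a b (S.id n) = (obj 𝒩 S).ren (a.symm.trans b) :=
  Quot.sound (.gen_id a b)

/-- A change of the lists of names. -/
theorem ren_comp_arr_comp_ren {n m : ℕ} {A B A' B' : Finset 𝒩} (a : Fin n ≃ A) (b : Fin m ≃ B)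
    (a' : Fin n ≃ A') (b' : Fin m ≃ B') (f : S.Hom n m) :
    (obj 𝒩 S).comp ((obj 𝒩 S).ren (a'.symm.trans a))
      ((obj 𝒩 S).comp (arr a b f) ((obj 𝒩 S).ren (b.symm.trans b'))) = arr a' b' f := by
  rw [← arr_id, ← arr_id, ← arr_comp, ← arr_comp, S.comp_id, S.id_comp]

theorem arr_perm {n m : ℕ} {A B : Finset 𝒩} (a : Fin n ≃ A) (b : Fin m ≃ B) (e : Fin n ≃ Fin m) :
    arr a b (S.perm e) = (obj 𝒩 S).ren (a.symm.trans (e.trans b)) := by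
  obtain rfl : n = m := by simpa using Fintype.card_congr e
  obtain ⟨w, hw⟩ := SymWord.toEquiv_surjective e
  -- In `[a⟩ id;⟨b|b'⟩ ⟨b] = [a⟩ id ⟨b] ; [b'|b]`, the list `b' = e.symm.trans b` is chosen so that
  -- `⟨b|b'⟩` has underlying bijection `e`.
  have h : (obj 𝒩 S).comp (arr a b (S.id n)) ((obj 𝒩 S).ren ((e.symm.trans b).symm.trans b)) = _ :=
    Quot.sound ((Rel.gen_comp_symm a b (e.symm.trans b) b (S.id n) w (by ext; simp [hw])).symm)
  rw [S.id_comp, S.eval_eq_perm w hw] at h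
  refine (Eq.trans ?_ h).symm
  rw [arr_id, ← NPROP.ren_trans]
  congr 1
  ext; simp

theorem arr_perm_self {n m : ℕ} {A : Finset 𝒩} (a : Fin n ≃ A) (a' : Fin m ≃ A) :
    arr a a' (S.perm (a.trans a'.symm)) = (obj 𝒩 S).id A := by
  rw [arr_perm, ← NPROP.ren_refl]
  congr 1; ext; simp

/-- It rewrites a generator in other lists with the same sets of names, the price being a
permutation on each side of `f`. -/
theorem arr_perm_comp_perm {n m n' m' : ℕ} {A B : Finset 𝒩} (a : Fin n ≃ A) (b : Fin m ≃ B)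
    (a' : Fin n' ≃ A) (b' : Fin m' ≃ B) (f : S.Hom n' m') :
    arr a b (S.comp (S.perm (a.trans a'.symm)) (S.comp f (S.perm (b'.trans b.symm)))) =
      arr a' b' f := by
  rw [arr_comp a a' b, arr_comp a' b' b, arr_perm_self, arr_perm_self, NPROP.id_comp,
    NPROP.comp_id]

/-- The lists are arbitrary in the induction, so that those of the two halves of a composite or
tensor can be chosen to match; the equations then fuse two generators into one. -/
theorem exists_arr_eq {n m : ℕ} {A B : Finset 𝒩} (a : Fin n ≃ A) (b : Fin m ≃ B)
    (t : Term 𝒩 S A B) : ∃ f : S.Hom n m, arr a b f = Quot.mk _ t := by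
  induction t generalizing n m with
  | @gen n' m' A B a' b' f =>
    exact ⟨_, arr_perm_comp_perm a b a' b' f⟩
  | id A =>
    refine ⟨S.perm (a.trans b.symm), (arr_perm a b _).trans ?_⟩
    refine Eq.trans ?_ ((obj 𝒩 S).ren_refl A)
    congr 1; ext; simp
  | ren e =>
    refine ⟨S.perm (a.trans (e.trans b.symm)), (arr_perm a b _).trans ?_⟩
    change (obj 𝒩 S).ren _ = (obj 𝒩 S).ren e
    congr 1; ext; simp
  | @comp A B C t s ht hs =>
    obtain ⟨f, hf⟩ := ht a (Model.enum B)
    obtain ⟨g, hg⟩ := hs (Model.enum B) b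
    refine ⟨S.comp f g, (arr_comp a (Model.enum B) b f g).trans ?_⟩
    rw [hf, hg]
    rfl
  | @tensor A A' C B B' D hC hD t s ht hs =>
    -- The halves are listed by `enum`; the concatenation has the length of the prescribed list and
    -- differs from it by a permutation, removed at the end.
    have hk : A.card + A'.card = n := by
      rw [← Finset.card_union_of_disjoint hC.1, hC.2]
      simpa using (Fintype.card_congr a).symm
    have hl : B.card + B'.card = m := by
      rw [← Finset.card_union_of_disjoint hD.1, hD.2]
      simpa using (Fintype.card_congr b).symm
    obtain ⟨f, hf⟩ := ht (Model.enum A) (Model.enum B)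
    obtain ⟨g, hg⟩ := hs (Model.enum A') (Model.enum B')
    have := arr_tensor hk hl hC hD (Model.enum A) (Model.enum A') (Model.enum B) (Model.enum B') f g
    rw [hf, hg] at this
    exact ⟨_, (arr_perm_comp_perm a b _ _ _).trans this⟩

theorem arr_bijective {n m : ℕ} {A B : Finset 𝒩} (a : Fin n ≃ A) (b : Fin m ≃ B) :
    Function.Bijective fun f : S.Hom n m => arr a b f :=
  ⟨arr_injective a b, by rintro ⟨t⟩; exact exists_arr_eq a b t⟩

end NOM

/-! ## A model of `ORD(T)` -/

namespace NPROP

variable {T : NPROP.{u} 𝒩}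

theorem ren_comp_ren {A B C : Finset 𝒩} (e : A ≃ B) (e' : B ≃ C) :
    T.comp (T.ren e) (T.ren e') = T.ren (e.trans e') := (T.ren_trans e e').symm

theorem ren_comp_ren_comp {A B C D : Finset 𝒩} (e : A ≃ B) (e' : B ≃ C) (f : T.Hom C D) :
    T.comp (T.ren e) (T.comp (T.ren e') f) = T.comp (T.ren (e.trans e')) f := by
  rw [← T.assoc, T.ren_trans]

theorem ren_eq_id {A : Finset 𝒩} {e : A ≃ A} (h : ∀ x, e x = x) : T.ren e = T.id A := by
  rw [← T.ren_refl]
  congr 1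
  exact Equiv.ext h

end NPROP

namespace ORD.Model

variable [Infinite 𝒩]

variable (𝒩) in
/-- A set of `n` names. -/
def names (n : ℕ) : Finset 𝒩 := (Infinite.exists_subset_card_eq 𝒩 n).choose

variable (𝒩) in
/-- A list of `n` names. -/
def list (n : ℕ) : Fin n ≃ names 𝒩 n :=
  ((names 𝒩 n).equivFinOfCardEq (Infinite.exists_subset_card_eq 𝒩 n).choose_spec).symm

variable {T : NPROP.{u} 𝒩}

/-- The arrow obtained from an arrow between the chosen sets of names by renaming. -/
def coord {n m : ℕ} {A B : Finset 𝒩} (a : Fin n ≃ A) (b : Fin m ≃ B)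
    (f : T.Hom (names 𝒩 n) (names 𝒩 m)) : T.Hom A B :=
  T.comp (T.ren (a.symm.trans (list 𝒩 n))) (T.comp f (T.ren ((list 𝒩 m).symm.trans b)))

/-- The inverse of `coord a b`. -/
def ofCoord {n m : ℕ} {A B : Finset 𝒩} (a : Fin n ≃ A) (b : Fin m ≃ B) (f : T.Hom A B) :
    T.Hom (names 𝒩 n) (names 𝒩 m) :=
  T.comp (T.ren ((list 𝒩 n).symm.trans a)) (T.comp f (T.ren (b.symm.trans (list 𝒩 m))))

theorem coord_ofCoord {n m : ℕ} {A B : Finset 𝒩} (a : Fin n ≃ A) (b : Fin m ≃ B) (f : T.Hom A B) :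
    coord a b (ofCoord a b f) = f := by
  simp only [coord, ofCoord, T.assoc, NPROP.ren_comp_ren_comp, NPROP.ren_comp_ren]
  rw [NPROP.ren_eq_id (by simp), NPROP.ren_eq_id (by simp), T.id_comp, T.comp_id]

theorem ofCoord_coord {n m : ℕ} {A B : Finset 𝒩} (a : Fin n ≃ A) (b : Fin m ≃ B)
    (f : T.Hom (names 𝒩 n) (names 𝒩 m)) : ofCoord a b (coord a b f) = f := by
  simp only [coord, ofCoord, T.assoc, NPROP.ren_comp_ren_comp, NPROP.ren_comp_ren]
  rw [NPROP.ren_eq_id (by simp), NPROP.ren_eq_id (by simp), T.id_comp, T.comp_id]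

theorem coord_injective {n m : ℕ} {A B : Finset 𝒩} (a : Fin n ≃ A) (b : Fin m ≃ B) :
    Function.Injective (coord (T := T) a b) :=
  Function.LeftInverse.injective (ofCoord_coord a b)

theorem coord_change {n m : ℕ} {A B A' B' : Finset 𝒩} (a : Fin n ≃ A) (b : Fin m ≃ B)
    (a' : Fin n ≃ A') (b' : Fin m ≃ B') (f : T.Hom (names 𝒩 n) (names 𝒩 m)) :
    coord a' b' f =
      T.comp (T.ren (a'.symm.trans a)) (T.comp (coord a b f) (T.ren (b.symm.trans b'))) := by
  have h : (a'.symm.trans a).trans (a.symm.trans (list 𝒩 n)) = a'.symm.trans (list 𝒩 n) := by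
    ext; simp
  have h' : ((list 𝒩 m).symm.trans b).trans (b.symm.trans b') = (list 𝒩 m).symm.trans b' := by
    ext; simp
  simp only [coord, T.assoc, NPROP.ren_comp_ren_comp, NPROP.ren_comp_ren, h, h']

theorem coord_id {n : ℕ} {A B : Finset 𝒩} (a : Fin n ≃ A) (b : Fin n ≃ B) :
    coord a b (T.id (names 𝒩 n)) = T.ren (a.symm.trans b) := by
  simp only [coord, T.id_comp, NPROP.ren_comp_ren]
  congr 1; ext; simp

theorem coord_comp {n m k : ℕ} {A B C : Finset 𝒩} (a : Fin n ≃ A) (b : Fin m ≃ B) (c : Fin k ≃ C)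
    (f : T.Hom (names 𝒩 n) (names 𝒩 m)) (g : T.Hom (names 𝒩 m) (names 𝒩 k)) :
    coord a c (T.comp f g) = T.comp (coord a b f) (coord b c g) := by
  simp only [coord, T.assoc, NPROP.ren_comp_ren_comp]
  rw [NPROP.ren_eq_id (e := ((list 𝒩 m).symm.trans b).trans (b.symm.trans (list 𝒩 m))) (by simp),
    T.id_comp]

variable (T) in
/-- The arrow of the model given by a bijection. -/
def perm {n m : ℕ} (e : Fin n ≃ Fin m) : T.Hom (names 𝒩 n) (names 𝒩 m) :=
  T.ren ((list 𝒩 n).symm.trans (e.trans (list 𝒩 m)))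

theorem coord_perm {n m : ℕ} {A B : Finset 𝒩} (a : Fin n ≃ A) (b : Fin m ≃ B)
    (e : Fin n ≃ Fin m) : coord a b (perm T e) = T.ren (a.symm.trans (e.trans b)) := by
  simp only [coord, perm, NPROP.ren_comp_ren]
  congr 1; ext; simp

theorem perm_trans {n m k : ℕ} (e : Fin n ≃ Fin m) (e' : Fin m ≃ Fin k) :
    perm T (e.trans e') = T.comp (perm T e) (perm T e') := by
  simp only [perm, NPROP.ren_comp_ren]
  congr 1; ext; simp

theorem perm_refl (n : ℕ) : perm T (Equiv.refl (Fin n)) = T.id (names 𝒩 n) :=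
  NPROP.ren_eq_id (by simp)

/-- The tensor of the model. -/
def tensor {n n' k m m' l : ℕ} (hk : n + n' = k) (hl : m + m' = l)
    (f : T.Hom (names 𝒩 n) (names 𝒩 m)) (g : T.Hom (names 𝒩 n') (names 𝒩 m')) :
    T.Hom (names 𝒩 k) (names 𝒩 l) :=
  have h := IsDisjUnion.exists_append hk (list 𝒩 k)
  have h' := IsDisjUnion.exists_append hl (list 𝒩 l)
  T.tensor h.choose_spec.choose_spec.choose h'.choose_spec.choose_spec.choose
    (coord h.choose_spec.choose_spec.choose_spec.choose
      h'.choose_spec.choose_spec.choose_spec.choose f)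
    (coord h.choose_spec.choose_spec.choose_spec.choose_spec.choose
      h'.choose_spec.choose_spec.choose_spec.choose_spec.choose g)

/-- The chosen sets `names n` and `names n'` need not be disjoint. Therefore `tensor` cuts `list k`
and `list l` in two and renames `f` and `g` onto the pieces. -/
theorem exists_tensor_eq {n n' k m m' l : ℕ} (hk : n + n' = k) (hl : m + m' = l)
    (f : T.Hom (names 𝒩 n) (names 𝒩 m)) (g : T.Hom (names 𝒩 n') (names 𝒩 m')) :
    ∃ (A A' B B' : Finset 𝒩) (hC : IsDisjUnion A A' (names 𝒩 k))
      (hD : IsDisjUnion B B' (names 𝒩 l)) (a : Fin n ≃ A) (a' : Fin n' ≃ A')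
      (b : Fin m ≃ B) (b' : Fin m' ≃ B'), hC.append hk a a' = list 𝒩 k ∧
        hD.append hl b b' = list 𝒩 l ∧
        tensor hk hl f g = T.tensor hC hD (coord a b f) (coord a' b' g) :=
  have h := IsDisjUnion.exists_append hk (list 𝒩 k)
  have h' := IsDisjUnion.exists_append hl (list 𝒩 l)
  ⟨_, _, _, _, _, _, _, _, _, _, h.choose_spec.choose_spec.choose_spec.choose_spec.choose_spec,
    h'.choose_spec.choose_spec.choose_spec.choose_spec.choose_spec, rfl⟩

theorem append_symm_trans {A A' C B B' D : Finset 𝒩} (hC : IsDisjUnion A A' C)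
    (hD : IsDisjUnion B B' D) {n n' k : ℕ} (hk : n + n' = k) (a : Fin n ≃ A) (a' : Fin n' ≃ A')
    (b : Fin n ≃ B) (b' : Fin n' ≃ B') :
    (hC.append hk a a').symm.trans (hD.append hk b b') =
      hC.bij hD (a.symm.trans b) (a'.symm.trans b') := by
  have h : hD.append hk b b' =
      (hC.append hk a a').trans (hC.bij hD (a.symm.trans b) (a'.symm.trans b')) := by
    rw [IsDisjUnion.append_trans_bij]
    congr 1 <;> ext <;> simp
  rw [h]
  ext
  simp

theorem coord_tensor {n n' k m m' l : ℕ} (hk : n + n' = k) (hl : m + m' = l)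
    {A A' C B B' D : Finset 𝒩} (hC : IsDisjUnion A A' C) (hD : IsDisjUnion B B' D)
    (a : Fin n ≃ A) (a' : Fin n' ≃ A') (b : Fin m ≃ B) (b' : Fin m' ≃ B')
    (f : T.Hom (names 𝒩 n) (names 𝒩 m)) (g : T.Hom (names 𝒩 n') (names 𝒩 m')) :
    coord (hC.append hk a a') (hD.append hl b b') (tensor hk hl f g) =
      T.tensor hC hD (coord a b f) (coord a' b' g) := by
  obtain ⟨P, P', Q, Q', hP, hQ, p, p', q, q', h, h', e⟩ := exists_tensor_eq hk hl f g
  have e' : coord (list 𝒩 k) (list 𝒩 l) (tensor hk hl f g) =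
      T.tensor hP hQ (coord p q f) (coord p' q' g) := by
    rw [← e, coord, NPROP.ren_eq_id (by simp), NPROP.ren_eq_id (by simp), T.id_comp, T.comp_id]
  -- Passing from the chosen pieces to the given sets is a renaming of the form `e ⊎ e'`, which the
  -- interchange law distributes over the two factors.
  rw [coord_change (list 𝒩 k) (list 𝒩 l), e', ← h, ← h', append_symm_trans, append_symm_trans,
    ← T.ren_tensor, ← T.ren_tensor, ← T.interchange, ← T.interchange, ← coord_change,
    ← coord_change]

theorem perm_finSum {n n' k m m' l : ℕ} (hk : n + n' = k) (hl : m + m' = l)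
    (e : Fin n ≃ Fin m) (e' : Fin n' ≃ Fin m') :
    perm T (finSum hk hl e e') = tensor hk hl (perm T e) (perm T e') := by
  obtain ⟨A, A', hC, a, a', ha⟩ := IsDisjUnion.exists_append hk (list 𝒩 k)
  obtain ⟨B, B', hD, b, b', hb⟩ := IsDisjUnion.exists_append hl (list 𝒩 l)
  apply coord_injective (hC.append hk a a') (hD.append hl b b')
  rw [coord_tensor, coord_perm, coord_perm, coord_perm, IsDisjUnion.finSum_trans_append,
    append_symm_trans, T.ren_tensor]

variable (T)

/-- The prop whose arrows `n → m` are the arrows of `T` between chosen sets of `n` and `m` names. -/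
def obj : PROP.{u} where
  Hom n m := T.Hom (names 𝒩 n) (names 𝒩 m)
  id n := T.id (names 𝒩 n)
  comp := T.comp
  tensor := tensor
  braid m n _ _ hk hl := perm T (finBraid m n hk hl)
  id_comp := T.id_comp
  comp_id := T.comp_id
  assoc := T.assoc
  tensor_id hk := by
    -- Laws involving only identities and symmetries are carried over from `bijPROP` by `perm`; the
    -- others are tested in concatenated coordinates.
    rw [← perm_refl, ← perm_refl, ← perm_refl, ← perm_finSum]
    exact congrArg (perm T) (bijPROP.tensor_id hk)
  interchange {n m p n' m' p' k l q} hk hl hq f g f' g' := by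
    obtain ⟨A, A', hA, a, a', -⟩ := IsDisjUnion.exists_append hk (list 𝒩 k)
    obtain ⟨B, B', hB, b, b', -⟩ := IsDisjUnion.exists_append hl (list 𝒩 l)
    obtain ⟨C, C', hC, c, c', -⟩ := IsDisjUnion.exists_append hq (list 𝒩 q)
    apply coord_injective (hA.append hk a a') (hC.append hq c c')
    rw [coord_tensor, coord_comp a b c, coord_comp a' b' c', T.interchange hA hB hC,
      ← coord_tensor hk hl hA hB, ← coord_tensor hl hq hB hC, ← coord_comp]
  tensor_assoc {n₁ n₂ n₃ n₁₂ n₂₃ n m₁ m₂ m₃ m₁₂ m₂₃ m} h₁ h₂ h₃ h₄ h₅ h₆ h₇ h₈ f g h := by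
    obtain ⟨A₁, A₂₃, hA', a₁, a₂₃, -⟩ := IsDisjUnion.exists_append h₄ (list 𝒩 n)
    obtain ⟨A₂, A₃, hA₂₃, a₂, a₃, -⟩ := IsDisjUnion.exists_append h₃ a₂₃
    obtain ⟨B₁, B₂₃, hB', b₁, b₂₃, -⟩ := IsDisjUnion.exists_append h₈ (list 𝒩 m)
    obtain ⟨B₂, B₃, hB₂₃, b₂, b₃, -⟩ := IsDisjUnion.exists_append h₇ b₂₃
    obtain ⟨hA₁₂, hA⟩ := hA'.assoc hA₂₃
    obtain ⟨hB₁₂, hB⟩ := hB'.assoc hB₂₃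
    apply coord_injective (hA.append h₂ (hA₁₂.append h₁ a₁ a₂) a₃)
      (hB.append h₆ (hB₁₂.append h₅ b₁ b₂) b₃)
    rw [coord_tensor, coord_tensor, T.tensor_assoc hA₁₂ hA hA₂₃ hA' hB₁₂ hB hB₂₃ hB',
      IsDisjUnion.append_assoc hA₁₂ hA hA₂₃ hA' h₁ h₂ h₃ h₄,
      IsDisjUnion.append_assoc hB₁₂ hB hB₂₃ hB' h₅ h₆ h₇ h₈, coord_tensor, coord_tensor]
  unit_tensor {n m} hn hm f := by
    have a₀ : Fin 0 ≃ (∅ : Finset 𝒩) := (Finset.equivFin ∅).symm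
    have hA : IsDisjUnion ∅ (names 𝒩 n) (names 𝒩 n) := ⟨by simp, by simp⟩
    have hB : IsDisjUnion ∅ (names 𝒩 m) (names 𝒩 m) := ⟨by simp, by simp⟩
    apply coord_injective (hA.append hn a₀ (list 𝒩 n)) (hB.append hm a₀ (list 𝒩 m))
    rw [coord_tensor, coord_id, NPROP.ren_eq_id (by simp), T.unit_tensor,
      IsDisjUnion.empty_append, IsDisjUnion.empty_append]
  tensor_unit {n m} hn hm f := by
    have a₀ : Fin 0 ≃ (∅ : Finset 𝒩) := (Finset.equivFin ∅).symm
    have hA : IsDisjUnion (names 𝒩 n) ∅ (names 𝒩 n) := ⟨by simp, by simp⟩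
    have hB : IsDisjUnion (names 𝒩 m) ∅ (names 𝒩 m) := ⟨by simp, by simp⟩
    apply coord_injective (hA.append hn (list 𝒩 n) a₀) (hB.append hm (list 𝒩 m) a₀)
    rw [coord_tensor, coord_id, NPROP.ren_eq_id (by simp), T.tensor_unit,
      IsDisjUnion.append_empty, IsDisjUnion.append_empty]
  braid_natural {n m n' m' k k' l l'} hk hk' hl hl' f g := by
    obtain ⟨A, A', hA, a, a', -⟩ := IsDisjUnion.exists_append hk (list 𝒩 k)
    obtain ⟨B, B', hB, b, b', -⟩ := IsDisjUnion.exists_append hl (list 𝒩 l)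
    -- With the outputs listed in the exchanged order both symmetries become identity renamings, and
    -- what is left is commutativity of `⊎` in `T`.
    apply coord_injective (hA.append hk a a') (hB.symm.append hl' b' b)
    rw [coord_comp _ (hB.append hl b b'), coord_comp _ (hA.symm.append hk' a' a),
      coord_tensor, coord_tensor, coord_perm, coord_perm, ← hB.append_comm,
      ← hA.append_comm, NPROP.ren_eq_id (by simp), NPROP.ren_eq_id (by simp), T.id_comp,
      T.comp_id]
    exact T.tensor_comm _ _ _ _ _ _
  braid_symm hk hl := by
    rw [← perm_trans, ← perm_refl]
    exact congrArg (perm T) (bijPROP.braid_symm hk hl)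
  hexagon h₁ h₂ h₃ h₄ h₅ h₆ h₇ h₈ h₉ h₁₀ h₁₁ := by
    rw [← perm_refl, ← perm_refl, ← perm_finSum, ← perm_finSum, ← perm_trans]
    exact congrArg (perm T) (bijPROP.hexagon h₁ h₂ h₃ h₄ h₅ h₆ h₇ h₈ h₉ h₁₀ h₁₁)

theorem eval_obj {n m : ℕ} (w : SymWord n m) :
    w.eval (obj T).toPropSig = perm T w.toEquiv := by
  induction w with
  | id n => exact (perm_refl n).symm
  | comp v w hv hw => exact (congrArg₂ T.comp hv hw).trans (perm_trans _ _).symm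
  | tensor hk hl v w hv hw =>
    exact (congrArg₂ (tensor hk hl) hv hw).trans (perm_finSum hk hl _ _).symm
  | braid m n hk hl => rfl

variable {T}

/-- The interpretation of terms in the model, with `⟨a] f [b⟩` having the coordinates `f`. -/
def eval : {n m : ℕ} → Term T n m → (obj T).Hom n m
  | _, _, .gen a b f => ofCoord a b f
  | _, _, .id n => (obj T).id n
  | _, _, .comp t s => (obj T).comp (eval t) (eval s)
  | _, _, .tensor hk hl t s => (obj T).tensor hk hl (eval t) (eval s)
  | _, _, .braid m n hk hl => (obj T).braid m n hk hl

/-- The words occurring in the last two defining equations are terms of `ORD(T)`; in the model they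
are renamings, which is what those equations compare. -/
theorem eval_eval {n m : ℕ} (w : SymWord n m) :
    eval (w.eval (termSig T)) = perm T w.toEquiv := by
  rw [← eval_obj]
  induction w with
  | id n => rfl
  | comp v w hv hw => exact congrArg₂ (obj T).comp hv hw
  | tensor hk hl v w hv hw => exact congrArg₂ ((obj T).tensor hk hl) hv hw
  | braid m n hk hl => rfl

theorem eval_rel {n m : ℕ} {t s : Term T n m} (h : Rel T t s) : eval t = eval s := by
  induction h with
  | refl t => rfl
  | symm _ ih => exact ih.symm
  | trans _ _ ih ih' => exact ih.trans ih'
  | comp_congr _ _ ih ih' => exact congrArg₂ _ ih ih'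
  | tensor_congr hk hl _ _ ih ih' => exact congrArg₂ _ ih ih'
  | id_comp t => exact (obj T).id_comp _
  | comp_id t => exact (obj T).comp_id _
  | assoc t s r => exact (obj T).assoc _ _ _
  | tensor_id hk => exact (obj T).tensor_id hk
  | interchange hk hl hq t s t' s' => exact (obj T).interchange hk hl hq _ _ _ _
  | tensor_assoc h₁ h₂ h₃ h₄ h₅ h₆ h₇ h₈ t s r =>
    exact (obj T).tensor_assoc h₁ h₂ h₃ h₄ h₅ h₆ h₇ h₈ _ _ _
  | unit_tensor hn hm t => exact (obj T).unit_tensor hn hm _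
  | tensor_unit hn hm t => exact (obj T).tensor_unit hn hm _
  | braid_natural hk hk' hl hl' t s => exact (obj T).braid_natural hk hk' hl hl' _ _
  | braid_symm hk hl => exact (obj T).braid_symm hk hl
  | hexagon h₁ h₂ h₃ h₄ h₅ h₆ h₇ h₈ h₉ h₁₀ h₁₁ =>
    exact (obj T).hexagon h₁ h₂ h₃ h₄ h₅ h₆ h₇ h₈ h₉ h₁₀ h₁₁
  | gen_comp a b c f g =>
    apply coord_injective a c
    change coord a c (ofCoord a c _) = coord a c (T.comp (ofCoord a b f) (ofCoord b c g))
    rw [coord_comp a b c, coord_ofCoord, coord_ofCoord, coord_ofCoord]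
  | gen_tensor hk hl hC hD a c b d f g =>
    apply coord_injective (hC.append hk a c) (hD.append hl b d)
    change coord _ _ (ofCoord _ _ _) = coord _ _ (tensor hk hl (ofCoord a b f) (ofCoord c d g))
    rw [coord_tensor, coord_ofCoord, coord_ofCoord, coord_ofCoord]
  | gen_id a =>
    apply coord_injective a a
    change coord a a (ofCoord a a _) = coord a a (T.id _)
    rw [coord_ofCoord, coord_id]
    exact (NPROP.ren_eq_id (by simp)).symm
  | gen_ren_comp a a' b c f w hw =>
    apply coord_injective a c
    refine Eq.trans ?_ (congrArg (fun x => coord a c (T.comp x (ofCoord b c f))) (eval_eval w)).symm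
    change coord a c (ofCoord a c _) = _
    simp only [coord_comp a b c, coord_ofCoord, coord_perm, hw]
    congr 2; ext; simp
  | gen_comp_ren a b c c' f w hw =>
    apply coord_injective a c'
    refine Eq.trans ?_
      (congrArg (fun x => coord a c' (T.comp (ofCoord a b f) x)) (eval_eval w)).symm
    change coord a c' (ofCoord a c' _) = _
    simp only [coord_comp a b c', coord_ofCoord, coord_perm, hw]
    congr 2; ext; simp

end ORD.Model

/-! ### Arrows of `ORD(T)` in given lists are arrows of `T` -/

namespace ORD

variable {T : NPROP.{u} 𝒩}

theorem arr_injective [Infinite 𝒩] {n m : ℕ} {A B : Finset 𝒩} (a : Fin n ≃ A) (b : Fin m ≃ B) :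
    Function.Injective fun f : T.Hom A B => arr a b f := fun f g h => by
  have := congrArg (Quot.lift Model.eval fun _ _ => Model.eval_rel) h
  have h' : Model.ofCoord a b f = Model.ofCoord a b g := this
  rw [← Model.coord_ofCoord a b f, h', Model.coord_ofCoord]

theorem arr_comp {n m k : ℕ} {A B C : Finset 𝒩} (a : Fin n ≃ A) (b : Fin m ≃ B) (c : Fin k ≃ C)
    (f : T.Hom A B) (g : T.Hom B C) :
    arr a c (T.comp f g) = (obj T).comp (arr a b f) (arr b c g) :=
  Quot.sound (.gen_comp a b c f g)

theorem arr_tensor {n n' k m m' l : ℕ} (hk : n + n' = k) (hl : m + m' = l)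
    {A A' C B B' D : Finset 𝒩} (hC : IsDisjUnion A A' C) (hD : IsDisjUnion B B' D)
    (a : Fin n ≃ A) (c : Fin n' ≃ A') (b : Fin m ≃ B) (d : Fin m' ≃ B')
    (f : T.Hom A B) (g : T.Hom A' B') :
    arr (hC.append hk a c) (hD.append hl b d) (T.tensor hC hD f g) =
      (obj T).tensor hk hl (arr a b f) (arr c d g) :=
  Quot.sound (.gen_tensor hk hl hC hD a c b d f g)

theorem arr_id {n : ℕ} {A : Finset 𝒩} (a : Fin n ≃ A) : arr a a (T.id A) = (obj T).id n :=
  Quot.sound (.gen_id a)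

theorem mk_eval {n m : ℕ} (w : SymWord n m) :
    (Quot.mk _ (w.eval (termSig T)) : (obj T).Hom n m) = (obj T).perm w.toEquiv := by
  rw [← (obj T).eval_eq_perm w rfl]
  induction w with
  | id n => rfl
  | comp v w hv hw => exact congrArg₂ (obj T).comp hv hw
  | tensor hk hl v w hv hw => exact congrArg₂ ((obj T).tensor hk hl) hv hw
  | braid m n hk hl => rfl

theorem arr_ren {n m : ℕ} {A B : Finset 𝒩} (a : Fin n ≃ A) (b : Fin m ≃ B) (e : A ≃ B) :
    arr a b (T.ren e) = (obj T).perm (a.trans (e.trans b.symm)) := by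
  obtain rfl : n = m := by simpa using Fintype.card_congr (a.trans (e.trans b.symm))
  obtain ⟨w, hw⟩ := SymWord.toEquiv_surjective (a.trans (e.trans b.symm))
  -- With `a' = b.trans e.symm` the renaming `[a'|b]` is `e`, and `⟨a|a'⟩` has the desired
  -- underlying bijection.
  have h : arr a b (T.comp (T.ren ((b.trans e.symm).symm.trans b)) (T.id B)) =
      (obj T).comp (Quot.mk _ (w.eval (termSig T))) (arr b b (T.id B)) :=
    Quot.sound (.gen_ren_comp a (b.trans e.symm) b b (T.id B) w (by rw [hw]; ext; simp))
  rw [T.comp_id, arr_id] at h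
  rw [← hw]
  refine Eq.trans ?_ (h.trans ((congrArg (fun x => (obj T).comp x ((obj T).id n)) (mk_eval w)).trans
    ((obj T).comp_id _)))
  congr 2; ext; simp

theorem perm_comp_arr_comp_perm {n m n' m' : ℕ} {A B : Finset 𝒩} (a : Fin n ≃ A) (b : Fin m ≃ B)
    (a' : Fin n' ≃ A) (b' : Fin m' ≃ B) (f : T.Hom A B) :
    (obj T).comp ((obj T).perm (a'.trans a.symm))
      ((obj T).comp (arr a b f) ((obj T).perm (b.trans b'.symm))) = arr a' b' f := by
  have h := arr_ren (T := T) a' a (Equiv.refl A)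
  have h' := arr_ren (T := T) b b' (Equiv.refl B)
  rw [Equiv.refl_trans] at h h'
  rw [← h, ← h', ← arr_comp, ← arr_comp, T.ren_refl, T.ren_refl, T.comp_id, T.id_comp]

/-- Relative to corresponding lists a renaming has the identity as its bijection, so it disappears.
This gives the independence of `η` from the lists and the formula for `ε`. -/
theorem arr_ren_comp_ren {n m : ℕ} {A B A' B' : Finset 𝒩} (a : Fin n ≃ A) (b : Fin m ≃ B)
    (a' : Fin n ≃ A') (b' : Fin m ≃ B') (f : T.Hom A' B') :
    arr a b (T.comp (T.ren (a.symm.trans a')) (T.comp f (T.ren (b'.symm.trans b)))) =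
      arr a' b' f := by
  rw [arr_comp a a' b, arr_comp a' b' b, arr_ren, arr_ren, PROP.perm_eq_id (by simp),
    PROP.perm_eq_id (by simp), PROP.id_comp, PROP.comp_id]

theorem exists_arr_eq [Infinite 𝒩] {n m : ℕ} {A B : Finset 𝒩} (a : Fin n ≃ A) (b : Fin m ≃ B)
    (t : Term T n m) : ∃ f : T.Hom A B, arr a b f = Quot.mk _ t := by
  induction t generalizing A B with
  | gen a' b' f => exact ⟨_, arr_ren_comp_ren a b a' b' f⟩
  | id n =>
    refine ⟨T.ren (a.symm.trans b), (arr_ren a b _).trans ?_⟩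
    exact PROP.perm_eq_id (by simp)
  | @comp n m k t s ht hs =>
    obtain ⟨f, hf⟩ := ht a (Model.list 𝒩 m)
    obtain ⟨g, hg⟩ := hs (Model.list 𝒩 m) b
    refine ⟨T.comp f g, (arr_comp a (Model.list 𝒩 m) b f g).trans ?_⟩
    rw [hf, hg]
    rfl
  | tensor hk hl t s ht hs =>
    -- Cutting the prescribed lists makes the name sets of the two factors disjoint, so their tensor
    -- in `T` is defined.
    obtain ⟨A, A', hC, a, a', rfl⟩ := IsDisjUnion.exists_append hk a
    obtain ⟨B, B', hD, b, b', rfl⟩ := IsDisjUnion.exists_append hl b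
    obtain ⟨f, hf⟩ := ht a b
    obtain ⟨g, hg⟩ := hs a' b'
    refine ⟨T.tensor hC hD f g, (arr_tensor hk hl hC hD a a' b b' f g).trans ?_⟩
    rw [hf, hg]
    rfl
  | braid m n hk hl =>
    refine ⟨T.ren (a.symm.trans ((finBraid m n hk hl).trans b)), (arr_ren a b _).trans ?_⟩
    refine Eq.trans ?_ ((obj T).perm_braid m n hk hl)
    congr 1; ext; simp

theorem arr_bijective [Infinite 𝒩] {n m : ℕ} {A B : Finset 𝒩} (a : Fin n ≃ A) (b : Fin m ≃ B) :
    Function.Bijective fun f : T.Hom A B => arr a b f :=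
  ⟨arr_injective a b, by rintro ⟨t⟩; exact exists_arr_eq a b t⟩

end ORD

end

section

variable {𝒩 : Type} [DecidableEq 𝒩] [Infinite 𝒩]

/-! ## The unit and the counit -/

/-- A bijective arrow of props is an isomorphism. -/
def PROPMor.isoOfBijective {S S' : PROP.{u}} (F : S ⟶ S')
    (h : ∀ n m, Function.Bijective (PROPMor.map F : S.Hom n m → S'.Hom n m)) : S ≅ S' where
  hom := F
  inv :=
    { map := fun {n m} => (Equiv.ofBijective _ (h n m)).symm
      -- Each law of the inverse is checked after applying `F`, which is injective.
      map_id := fun n => (Equiv.symm_apply_eq _).2 (PROPMor.map_id F n).symm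
      map_comp := fun f g => (Equiv.symm_apply_eq _).2 <| by
        refine Eq.trans ?_ (PROPMor.map_comp F _ _).symm
        exact congrArg₂ S'.comp (Equiv.apply_symm_apply (Equiv.ofBijective _ (h _ _)) f).symm
          (Equiv.apply_symm_apply (Equiv.ofBijective _ (h _ _)) g).symm
      map_tensor := fun hk hl f g => (Equiv.symm_apply_eq _).2 <| by
        refine Eq.trans ?_ (PROPMor.map_tensor F hk hl _ _).symm
        exact congrArg₂ (S'.tensor hk hl)
          (Equiv.apply_symm_apply (Equiv.ofBijective _ (h _ _)) f).symm
          (Equiv.apply_symm_apply (Equiv.ofBijective _ (h _ _)) g).symm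
      map_braid := fun m n _ _ hk hl =>
        (Equiv.symm_apply_eq _).2 (PROPMor.map_braid F m n hk hl).symm }
  hom_inv_id := PROPMor.ext <| by
    funext n m f
    exact Equiv.symm_apply_apply (Equiv.ofBijective _ (h n m)) f
  inv_hom_id := PROPMor.ext <| by
    funext n m f
    exact Equiv.apply_symm_apply (Equiv.ofBijective _ (h n m)) f

/-- Preservation of renamings implies equivariance. -/
theorem NPROP.map_act_of_map_ren {T T' : NPROP.{u} 𝒩}
    (F : ∀ {A B : Finset 𝒩}, T.Hom A B → T'.Hom A B)
    (hcomp : ∀ {A B C : Finset 𝒩} (f : T.Hom A B) (g : T.Hom B C),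
      F (T.comp f g) = T'.comp (F f) (F g))
    (hren : ∀ {A B : Finset 𝒩} (e : A ≃ B), F (T.ren e) = T'.ren e) (π : Equiv.Perm 𝒩)
    {A B : Finset 𝒩} (f : T.Hom A B) : F (T.act π f) = T'.act π (F f) := by
  simp only [NPROP.act, hcomp, hren]

/-- A bijective arrow of nominal props is an isomorphism. -/
def NPROPMor.isoOfBijective {T T' : NPROP.{u} 𝒩} (F : T ⟶ T')
    (h : ∀ A B, Function.Bijective (NPROPMor.map F : T.Hom A B → T'.Hom A B)) : T ≅ T' where
  hom := F
  inv :=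
    { map := fun {A B} => (Equiv.ofBijective _ (h A B)).symm
      map_id := fun A => (Equiv.symm_apply_eq _).2 (NPROPMor.map_id F A).symm
      map_comp := fun f g => (Equiv.symm_apply_eq _).2 <| by
        refine Eq.trans ?_ (NPROPMor.map_comp F _ _).symm
        exact congrArg₂ T'.comp (Equiv.apply_symm_apply (Equiv.ofBijective _ (h _ _)) f).symm
          (Equiv.apply_symm_apply (Equiv.ofBijective _ (h _ _)) g).symm
      map_tensor := fun hk hl f g => (Equiv.symm_apply_eq _).2 <| by
        refine Eq.trans ?_ (NPROPMor.map_tensor F hk hl _ _).symm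
        exact congrArg₂ (T'.tensor hk hl)
          (Equiv.apply_symm_apply (Equiv.ofBijective _ (h _ _)) f).symm
          (Equiv.apply_symm_apply (Equiv.ofBijective _ (h _ _)) g).symm
      map_act := fun π hπ _ _ f => (Equiv.symm_apply_eq _).2 <| by
        refine Eq.trans ?_ (NPROPMor.map_act F π hπ _).symm
        exact congrArg (T'.act π)
          (Equiv.apply_symm_apply (Equiv.ofBijective _ (h _ _)) f).symm }
  hom_inv_id := NPROPMor.ext <| by
    funext A B f
    exact Equiv.symm_apply_apply (Equiv.ofBijective _ (h A B)) f
  inv_hom_id := NPROPMor.ext <| by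
    funext A B f
    exact Equiv.apply_symm_apply (Equiv.ofBijective _ (h A B)) f

namespace Nominal

/-- The arrow `⟨a] [a⟩ f ⟨b] [b⟩` does not depend on the lists of names. -/
theorem ord_arr_nom_arr_eq {S : PROP.{u}} {n m : ℕ} {A B A' B' : Finset 𝒩} (a : Fin n ≃ A)
    (b : Fin m ≃ B) (a' : Fin n ≃ A') (b' : Fin m ≃ B') (f : S.Hom n m) :
    ORD.arr a b (NOM.arr a b f) = ORD.arr a' b' (NOM.arr a' b' f) := by
  rw [← NOM.ren_comp_arr_comp_ren a' b' a b f, ORD.arr_ren_comp_ren]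

/-- The arrow `[a⟩ ⟨a] f [b⟩ ⟨b]` does not depend on the lists of names. -/
theorem nom_arr_ord_arr_eq {T : NPROP.{u} 𝒩} {n m n' m' : ℕ} {A B : Finset 𝒩} (a : Fin n ≃ A)
    (b : Fin m ≃ B) (a' : Fin n' ≃ A) (b' : Fin m' ≃ B) (f : T.Hom A B) :
    NOM.arr a b (ORD.arr a b f) = NOM.arr a' b' (ORD.arr a' b' f) := by
  rw [← ORD.perm_comp_arr_comp_perm a' b' a b f, NOM.arr_perm_comp_perm]

open ORD.Model (list names)
open NOM.Model (enum)

/-- The unit `η`. -/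
def unit (S : PROP.{u}) : PROPMor S (ORD.obj (NOM.obj 𝒩 S)) where
  map {n m} f := ORD.arr (list 𝒩 n) (list 𝒩 m) (NOM.arr (list 𝒩 n) (list 𝒩 m) f)
  map_id n := by
    rw [NOM.arr_id, NPROP.ren_eq_id (by simp), ORD.arr_id]
  map_comp {n m k} f g := by
    rw [NOM.arr_comp _ (list 𝒩 m), ORD.arr_comp _ (list 𝒩 m)]
  map_tensor {n n' k m m' l} hk hl f g := by
    obtain ⟨A, A', hC, a, a', ha⟩ := IsDisjUnion.exists_append hk (list 𝒩 k)
    obtain ⟨B, B', hD, b, b', hb⟩ := IsDisjUnion.exists_append hl (list 𝒩 l)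
    -- The pieces of `list k` are not `list n` and `list n'`; independence of the lists bridges the
    -- difference.
    rw [← ha, ← hb, NOM.arr_tensor, ORD.arr_tensor, ord_arr_nom_arr_eq a b,
      ord_arr_nom_arr_eq a' b']
  map_braid m n k l hk hl := by
    rw [← S.perm_braid, NOM.arr_perm, ORD.arr_ren, ← PROP.perm_braid]
    congr 1; ext; simp

theorem unit_apply (S : PROP.{u}) {n m : ℕ} {A B : Finset 𝒩} (a : Fin n ≃ A) (b : Fin m ≃ B)
    (f : S.Hom n m) : (unit (𝒩 := 𝒩) S).map f = ORD.arr a b (NOM.arr a b f) :=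
  ord_arr_nom_arr_eq _ _ _ _ f

theorem unit_bijective (S : PROP.{u}) (n m : ℕ) :
    Function.Bijective ((unit (𝒩 := 𝒩) S).map : S.Hom n m → _) :=
  (ORD.arr_bijective (list 𝒩 n) (list 𝒩 m)).comp (NOM.arr_bijective (list 𝒩 n) (list 𝒩 m))

/-- The inverse of the counit `ε`. -/
def counitInv (T : NPROP.{u} 𝒩) : NPROPMor T (NOM.obj 𝒩 (ORD.obj T)) :=
  have hcomp {A B C : Finset 𝒩} (f : T.Hom A B) (g : T.Hom B C) :
      NOM.arr (enum A) (enum C) (ORD.arr (enum A) (enum C) (T.comp f g)) =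
        (NOM.obj 𝒩 (ORD.obj T)).comp (NOM.arr (enum A) (enum B) (ORD.arr (enum A) (enum B) f))
          (NOM.arr (enum B) (enum C) (ORD.arr (enum B) (enum C) g)) := by
    rw [ORD.arr_comp _ (enum B), NOM.arr_comp _ (enum B)]
  { map := fun {A B} f => NOM.arr (enum A) (enum B) (ORD.arr (enum A) (enum B) f)
    map_id := fun A => by
      rw [ORD.arr_id, NOM.arr_id, NPROP.ren_eq_id (by simp)]
    map_comp := hcomp
    map_tensor := fun {A A' C B B' D} hC hD f g => by
      rw [nom_arr_ord_arr_eq _ _ (hC.append rfl (enum A) (enum A'))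
        (hD.append rfl (enum B) (enum B')), ORD.arr_tensor, NOM.arr_tensor]
    map_act := fun π _ A B f => NPROP.map_act_of_map_ren (T' := NOM.obj 𝒩 (ORD.obj T))
      (fun {A B} f => NOM.arr (enum A) (enum B) (ORD.arr (enum A) (enum B) f)) hcomp
      (fun {A B} e => by
        rw [ORD.arr_ren, NOM.arr_perm]
        congr 1; ext; simp) π f }

theorem counitInv_apply (T : NPROP.{u} 𝒩) {n m : ℕ} {A B : Finset 𝒩} (a : Fin n ≃ A)
    (b : Fin m ≃ B) (f : T.Hom A B) : (counitInv T).map f = NOM.arr a b (ORD.arr a b f) :=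
  nom_arr_ord_arr_eq _ _ _ _ f

theorem counitInv_bijective (T : NPROP.{u} 𝒩) (A B : Finset 𝒩) :
    Function.Bijective ((counitInv T).map : T.Hom A B → _) :=
  (NOM.arr_bijective (enum A) (enum B)).comp (ORD.arr_bijective (enum A) (enum B))

variable (𝒩) in
/-- The unit as a natural isomorphism. -/
def unitIso : 𝟭 PROP.{u} ≅ NOM.{u} 𝒩 ⋙ ORD.{u} 𝒩 :=
  -- Naturality is definitional: the chosen lists do not depend on the prop, and the functors act
  -- only on the arrow inside a generator.
  NatIso.ofComponents (fun S => PROPMor.isoOfBijective (S' := (ORD 𝒩).obj ((NOM 𝒩).obj S)) (unit S)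
    (unit_bijective S)) fun _ => rfl

variable (𝒩) in
/-- The counit as a natural isomorphism. -/
def counitIso : ORD.{u} 𝒩 ⋙ NOM.{u} 𝒩 ≅ 𝟭 (NPROP.{u} 𝒩) :=
  Iso.symm <| NatIso.ofComponents
    (fun T => NPROPMor.isoOfBijective (T' := (NOM 𝒩).obj ((ORD 𝒩).obj T)) (counitInv T)
      (counitInv_bijective T)) fun _ => rfl

/-- A value of `ε` is computed by exhibiting its preimage under `ε`'s inverse, `counitInv`. -/
theorem counitIso_apply (T : NPROP.{u} 𝒩) {A B : Finset 𝒩}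
    (g : (NOM.obj 𝒩 (ORD.obj T)).Hom A B) (f : T.Hom A B) (h : (counitInv T).map f = g) :
    NPROPMor.map ((counitIso 𝒩).hom.app T) g = f :=
  (Equiv.symm_apply_eq (Equiv.ofBijective _ (counitInv_bijective T A B))).2 h.symm

end Nominal

end

end

/-! ### The adjoint equivalence -/

theorem mainTheorem1 (𝒩 : Type) [DecidableEq 𝒩] [Countable 𝒩] [Infinite 𝒩] :
    ∃ (E : PROP.{u} ≌ NPROP.{u} 𝒩)
      (η : 𝟭 PROP.{u} ≅ NOM.{u} 𝒩 ⋙ ORD.{u} 𝒩)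
      (ε : ORD.{u} 𝒩 ⋙ NOM.{u} 𝒩 ≅ 𝟭 (NPROP.{u} 𝒩))
      (h : ∀ S : PROP.{u},
        (NOM.{u} 𝒩).map (η.hom.app S) ≫ ε.hom.app ((NOM.{u} 𝒩).obj S) = 𝟙 ((NOM.{u} 𝒩).obj S)),
      E = { functor := NOM.{u} 𝒩
            inverse := ORD.{u} 𝒩
            unitIso := η
            counitIso := ε
            functor_unitIso_comp := h } ∧
      (∀ (S : PROP.{u}) (n m : ℕ) (A B : Finset 𝒩) (a : Fin n ≃ A) (b : Fin m ≃ B)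
        (f : S.Hom n m),
        (η.hom.app S).map f = ORD.arr a b (NOM.arr a b f)) ∧
      (∀ (T : NPROP.{u} 𝒩) (n m : ℕ) (A B C D : Finset 𝒩) (a : Fin n ≃ A) (b : Fin m ≃ B)
        (c : Fin n ≃ C) (d : Fin m ≃ D) (f : T.Hom A B),
        (ε.hom.app T).map (NOM.arr c d (ORD.arr a b f)) =
          T.comp (T.ren (c.symm.trans a)) (T.comp f (T.ren (b.symm.trans d)))) := by
  have h : ∀ S : PROP.{u}, (NOM.{u} 𝒩).map ((Nominal.unitIso 𝒩).hom.app S) ≫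
      (Nominal.counitIso 𝒩).hom.app ((NOM.{u} 𝒩).obj S) = 𝟙 ((NOM.{u} 𝒩).obj S) := fun S => by
    refine NPROPMor.ext ?_
    funext A B g
    -- It suffices to treat a generator `[a⟩ f ⟨b]`. There the triangle identity says that `ε⁻¹`
    -- sends it to `[a⟩ η(f) ⟨b]`, and both sides are `[a⟩ ⟨a] [a⟩ f ⟨b] [b⟩ ⟨b]`.
    obtain ⟨f, rfl⟩ := (NOM.arr_bijective (NOM.Model.enum A) (NOM.Model.enum B)).2 g
    refine Nominal.counitIso_apply _ _ _ ?_
    rw [Nominal.counitInv_apply _ (NOM.Model.enum A) (NOM.Model.enum B)]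
    exact congrArg (NOM.arr _ _) (Nominal.unit_apply S _ _ f).symm
  refine ⟨_, Nominal.unitIso 𝒩, Nominal.counitIso 𝒩, h, rfl,
    fun S n m A B a b f => Nominal.unit_apply S a b f,
    fun T n m A B C D a b c d f => Nominal.counitIso_apply T _ _ ?_⟩
  -- Expressing `ε⁻¹` in the lists `c`, `d` lets the renamings `[c|a]` and `[b|d]` be absorbed by
  -- the inner generator.
  rw [Nominal.counitInv_apply T c d, ORD.arr_ren_comp_ren]
  rfl
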